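/- Let $n\ge 1$, let $\mathbb{B}^n\subset\mathbb{C}^n$ be the open unit ball and let $SU(n,1)=\{A\in SL(n+1,\mathbb{C}) : A^T\sigma\bar A=\sigma\}$, $\sigma=\mathrm{diag}(1,\dots,1,-1)$, act on $\mathbb{B}^n$ by fractional-linear transformations, with complex Jacobian $J(\gamma,z)=(a_{n+1,1}z_1+\dots+a_{n+1,n}z_n+a_{n+1,n+1})^{-(n+1)}$ for $\gamma=(a_{jk})$. Put $\langle z,w\rangle=z_1\bar w_1+\dots+z_n\bar w_n-1$; let $\mathcal{K}(z,w)=\frac{n!}{\pi^n}(-\langle z,w\rangle)^{-(n+1)}$ be the Bergman kernel, $dV(z)=\mathcal{K}(z,z)\,dV_e(z)$ with $dV_e$ the Lebesgue measure, and let $\tau$ be the complex hyperbolic distance, $\cosh^2\frac{\tau(z,w)}{2}=\frac{\langle z,w\rangle\langle w,z\rangle}{\langle z,z\rangle\langle w,w\rangle}$. For $A,B\subset\mathbb{B}^n$ put $\mathrm{dist}(A,B)=\inf\{\tau(z,w): z\in A,\ w\in B\}$. For $k\ge 1$ let $c(\mathbb{B}^n,k)$ be the constant determined by $c(\mathbb{B}^n,k)\int_{\mathbb{B}^n}\mathcal{K}(0,w)^k\mathcal{K}(w,0)^k\mathcal{K}(w,w)^{-k}\,dV(w)=\mathcal{K}(0,0)^k$.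 Let $\Gamma$ be a discrete subgroup of $SU(n,1)$ with compact quotient $M=\Gamma\backslash\mathbb{B}^n$, such that every element of $\Gamma$ that fixes a point of $\mathbb{B}^n$ acts as the identity on $\mathbb{B}^n$ (so $M$ is smooth and the projection $\pi:\mathbb{B}^n\to M$ is a covering map). Let $\mathcal{F}=\{z : \tau(z,p_0)\le\tau(z,\gamma p_0)\ \forall\gamma\in\Gamma\}$ be the Dirichlet fundamental domain of $\Gamma$ centred at a point $p_0\in\mathbb{B}^n$. Let $X$ and $Y$ be embedded smooth submanifolds of $\mathbb{B}^n$, of real dimensions $q_X>0$ and $q_Y>0$, of the form $X=\pi^{-1}(X')\cap\mathcal{F}$ and $Y=\pi^{-1}(Y')\cap\mathcal{F}$, where $X',Y'$ are embedded submanifolds of $M$ of the same dimensions $q_X$, $q_Y$ and $\pi$ maps $X$ one-to-one onto $X'$ and $Y$ one-to-one onto $Y'$. Let $X$ and $Y$ be oriented, and let $\nu_X$, $\nu_Y$ be smooth real forms of degree $q_X$ on $X$ and $q_Y$ on $Y$ that are absolutely integrable and satisfy $\int_X\nu_X>0$, $\int_Y\nu_Y>0$. Denote $\tilde X=\Gamma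 X$. For a positive integer $m$, a unitary representation $\rho:\Gamma\to U(m)$, $j\in\{1,\dots,m\}$, $k\ge1$ and $p\in\mathbb{B}^n$ let $$\Theta_p^{(j;k)}(z)=c(\mathbb{B}^n,k)\sum_{\gamma\in\Gamma}J(\gamma,z)^k\,\mathcal{K}(\gamma z,p)^k\,\rho(\gamma^{-1})e_j\in\mathbb{C}^m ,$$ where $e_j$ is the $j$-th standard basis vector, let $$\Theta_X^{(j;k)}(z)=\int_X\Theta_p^{(j;k)}(z)\,\mathcal{K}(p,p)^{-k/2}\,\nu_X(p),$$ define $\Theta_Y^{(j;k)}$ in the same way from $Y$ and $\nu_Y$, and put $(F,G)=\int_{\mathcal{F}}F(z)^T\overline{G(z)}\,\mathcal{K}(z,z)^{-k}\,dV(z)$, the integral over $\Gamma\backslash\mathbb{B}^n$. (i) Suppose $\mathrm{dist}(\tilde X\setminus X,Y)>0$. Then for every $l\in\mathbb{N}$ there are constants $C$ and $k_0$, depending only on $l,n,X,Y,\Gamma,\nu_X,\nu_Y$, such that for every $m$, every unitary representation $\rho:\Gamma\to U(m)$ that is trivial on the elements of $\Gamma$ acting as the identity on $\mathbb{B}^n$,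 all $r\ne j$ in $\{1,\dots,m\}$ and all $k\ge k_0$, $$\bigl|(\Theta_X^{(r;k)},\Theta_Y^{(j;k)})\bigr|\le\frac{C}{k^l}.$$ (ii) Suppose $\mathrm{dist}(\tilde X,Y)>0$. Then for every $l\in\mathbb{N}$ there are constants $C$ and $k_0$, depending only on $l,n,X,Y,\Gamma,\nu_X,\nu_Y$, such that for every $m$, every unitary representation $\rho:\Gamma\to U(m)$, all $r,j\in\{1,\dots,m\}$ and all $k\ge k_0$, the same inequality holds. -/

import Mathlib

open MeasureTheory

noncomputable section

namespace BallQuotient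

/-! ### The group `SU(n,1)` and its action on the unit ball -/

/-- The open unit ball `𝔹ⁿ` of `ℂⁿ` (with the Euclidean norm). -/
abbrev Ball (n : ℕ) : Type := {z : EuclideanSpace ℂ (Fin n) // ‖z‖ < 1}

/-- Lebesgue measure `dV_e` on the ball. -/
def lebesgue (n : ℕ) : Measure (Ball n) :=
  (volume : Measure (EuclideanSpace ℂ (Fin n))).comap Subtype.val

/-- The centre of the ball. -/
def origin (n : ℕ) : Ball n := ⟨0, by simp⟩

/-- The matrix `σ = diag(1, …, 1, -1)` of size `n + 1`. -/
def sig (n : ℕ) : Matrix (Fin (n + 1)) (Fin (n + 1)) ℂ :=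
  Matrix.diagonal (Fin.snoc (fun _ : Fin n => (1 : ℂ)) (-1))

/-- `SU(n,1) = {A ∈ SL(n+1,ℂ) | Aᵀ σ Ā = σ}`. -/
def SU (n : ℕ) : Subgroup (Matrix.SpecialLinearGroup (Fin (n + 1)) ℂ) where
  carrier := {A | (A : Matrix (Fin (n + 1)) (Fin (n + 1)) ℂ).transpose * sig n *
    (A : Matrix (Fin (n + 1)) (Fin (n + 1)) ℂ).map (starRingEnd ℂ) = sig n}
  one_mem' := by simp [Matrix.map_one]
  mul_mem' := by
    intro A B hA hB
    simp only [Set.mem_ofPred_eq, Matrix.SpecialLinearGroup.coe_mul, Matrix.transpose_mul,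
      Matrix.map_mul] at *
    calc _ = (B : Matrix (Fin (n + 1)) (Fin (n + 1)) ℂ).transpose *
          ((A : Matrix (Fin (n + 1)) (Fin (n + 1)) ℂ).transpose * sig n *
            (A : Matrix (Fin (n + 1)) (Fin (n + 1)) ℂ).map (starRingEnd ℂ)) *
            (B : Matrix (Fin (n + 1)) (Fin (n + 1)) ℂ).map (starRingEnd ℂ) := by
            simp only [Matrix.mul_assoc]
      _ = _ := by rw [hA, hB]
  inv_mem' := by
    intro A hA
    simp only [Set.mem_ofPred_eq] at *
    have h1 : (A : Matrix (Fin (n + 1)) (Fin (n + 1)) ℂ) *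
        ((A⁻¹ : Matrix.SpecialLinearGroup (Fin (n + 1)) ℂ) : Matrix _ _ ℂ) = 1 := by
      rw [← Matrix.SpecialLinearGroup.coe_mul]; simp
    have h2 := congrArg Matrix.transpose h1
    have h3 := congrArg (fun N : Matrix (Fin (n + 1)) (Fin (n + 1)) ℂ => N.map (starRingEnd ℂ)) h1
    simp only [Matrix.transpose_mul, Matrix.transpose_one] at h2
    simp only [Matrix.map_mul] at h3
    rw [Matrix.map_one _ (map_zero _) (map_one _)] at h3
    conv_lhs => rw [← hA]
    calc _ = (((A⁻¹ : Matrix.SpecialLinearGroup (Fin (n + 1)) ℂ) : Matrix _ _ ℂ).transpose *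
          (A : Matrix (Fin (n + 1)) (Fin (n + 1)) ℂ).transpose) * sig n *
          ((A : Matrix (Fin (n + 1)) (Fin (n + 1)) ℂ).map (starRingEnd ℂ) *
          ((A⁻¹ : Matrix.SpecialLinearGroup (Fin (n + 1)) ℂ) : Matrix _ _ ℂ).map
            (starRingEnd ℂ)) := by simp only [Matrix.mul_assoc]
      _ = _ := by rw [h2, h3]; simp

/-- Homogeneous coordinates `(z₁, …, zₙ, 1)`. -/
def homog {n : ℕ} (z : EuclideanSpace ℂ (Fin n)) : Fin (n + 1) → ℂ :=
  Fin.snoc (fun i => z i) 1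

/-- The vector `A (z₁, …, zₙ, 1)ᵀ`. -/
def num {n : ℕ} (A : SU n) (z : EuclideanSpace ℂ (Fin n)) : Fin (n + 1) → ℂ :=
  ((A : Matrix.SpecialLinearGroup (Fin (n + 1)) ℂ) : Matrix _ _ ℂ).mulVec (homog z)

/-- The denominator `a_{n+1,1} z₁ + … + a_{n+1,n} zₙ + a_{n+1,n+1}`. -/
def den {n : ℕ} (A : SU n) (z : EuclideanSpace ℂ (Fin n)) : ℂ := num A z (Fin.last n)

/-- The fractional-linear transformation defined by `A`. -/
def act {n : ℕ} (A : SU n) (z : EuclideanSpace ℂ (Fin n)) : EuclideanSpace ℂ (Fin n) :=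
  WithLp.toLp 2 fun i => num A z i.castSucc / den A z

theorem dot_sig {n : ℕ} (v : Fin (n + 1) → ℂ) :
    v ⬝ᵥ (sig n).mulVec (fun i => starRingEnd ℂ (v i)) =
      (((∑ i : Fin n, ‖v i.castSucc‖ ^ 2) - ‖v (Fin.last n)‖ ^ 2 : ℝ) : ℂ) := by
  simp [sig, dotProduct, Matrix.mulVec_diagonal, Fin.sum_univ_castSucc, Complex.mul_conj']
  ring

theorem num_form {n : ℕ} (A : SU n) (z : EuclideanSpace ℂ (Fin n)) :
    (∑ i : Fin n, ‖num A z i.castSucc‖ ^ 2) - ‖den A z‖ ^ 2 = ‖z‖ ^ 2 - 1 := by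
  have hA : ((A : Matrix.SpecialLinearGroup (Fin (n + 1)) ℂ) : Matrix _ _ ℂ).transpose * sig n *
    ((A : Matrix.SpecialLinearGroup (Fin (n + 1)) ℂ) : Matrix _ _ ℂ).map (starRingEnd ℂ) =
      sig n := A.2
  have h1 := dot_sig (num A z)
  have h2 := dot_sig (homog z)
  have h3 : (fun i => starRingEnd ℂ (num A z i)) =
      (((A : Matrix.SpecialLinearGroup (Fin (n + 1)) ℂ) : Matrix _ _ ℂ).map
        (starRingEnd ℂ)).mulVec (fun i => starRingEnd ℂ (homog z i)) := by
    funext i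
    simp [num, Matrix.mulVec, dotProduct]
  have h4 : num A z ⬝ᵥ (sig n).mulVec (fun i => starRingEnd ℂ (num A z i)) =
      homog z ⬝ᵥ (sig n).mulVec (fun i => starRingEnd ℂ (homog z i)) := by
    rw [h3]
    conv_rhs => rw [← hA]
    rw [← Matrix.mulVec_mulVec, ← Matrix.mulVec_mulVec, Matrix.dotProduct_mulVec (homog z),
      Matrix.vecMul_transpose]
    rfl
  rw [h1, h2] at h4
  have h5 := Complex.ofReal_injective h4
  rw [den, h5]
  simp [homog, EuclideanSpace.norm_sq_eq]

theorem den_ne_zero {n : ℕ} (A : SU n) {z : EuclideanSpace ℂ (Fin n)} (hz : ‖z‖ < 1) :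
    den A z ≠ 0 := by
  intro h
  have := num_form A z
  rw [h] at this
  have h2 : 0 ≤ ∑ i : Fin n, ‖num A z i.castSucc‖ ^ 2 := by positivity
  have h3 : ‖z‖ ^ 2 < 1 := by nlinarith [norm_nonneg z]
  norm_num at this
  linarith

theorem norm_act_lt {n : ℕ} (A : SU n) {z : EuclideanSpace ℂ (Fin n)} (hz : ‖z‖ < 1) :
    ‖act A z‖ < 1 := by
  have hd : 0 < ‖den A z‖ ^ 2 := by have := norm_pos_iff.2 (den_ne_zero A hz); positivity
  have h3 : ‖z‖ ^ 2 < 1 := by nlinarith [norm_nonneg z]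
  have h1 : ‖act A z‖ ^ 2 = (∑ i : Fin n, ‖num A z i.castSucc‖ ^ 2) / ‖den A z‖ ^ 2 := by
    simp [EuclideanSpace.norm_sq_eq, act, div_pow, Finset.sum_div]
  have h2 : ‖act A z‖ ^ 2 < 1 := by
    rw [h1, div_lt_one hd]
    have := num_form A z
    linarith
  nlinarith [norm_nonneg (act A z)]

theorem homog_act {n : ℕ} (A : SU n) {z : EuclideanSpace ℂ (Fin n)} (hz : ‖z‖ < 1) :
    homog (act A z) = (den A z)⁻¹ • num A z := by
  funext i
  refine Fin.lastCases ?_ (fun i => ?_) i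
  · simp only [homog, Fin.snoc_last, Pi.smul_apply, smul_eq_mul]
    exact (inv_mul_cancel₀ (den_ne_zero A hz)).symm
  · simp [homog, act, div_eq_inv_mul]

theorem num_mul {n : ℕ} (A B : SU n) {z : EuclideanSpace ℂ (Fin n)} (hz : ‖z‖ < 1) :
    num A (act B z) = (den B z)⁻¹ • num (A * B) z := by
  rw [num, homog_act B hz, Matrix.mulVec_smul]
  simp [num]

instance (n : ℕ) : MulAction (SU n) (Ball n) where
  smul A z := ⟨act A z, norm_act_lt A z.2⟩
  one_smul := by
    rintro ⟨z, hz⟩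
    apply Subtype.ext
    change act 1 z = z
    ext i
    simp [act, num, den, homog]
  mul_smul := by
    rintro A B ⟨z, hz⟩
    apply Subtype.ext
    change act (A * B) z = act A (act B z)
    have h := den_ne_zero B hz
    ext i
    simp only [act, den]
    have := num_mul A B hz
    simp only [act, den] at this
    rw [this]
    simp only [Pi.smul_apply, smul_eq_mul]
    rw [mul_div_mul_left]
    exact inv_ne_zero h

/-- The complex Jacobian `J(γ,z) = (a_{n+1,1} z₁ + … + a_{n+1,n+1})^{-(n+1)}`. -/
def jac {n : ℕ} (A : SU n) (z : Ball n) : ℂ := 1 / den A (z : EuclideanSpace ℂ (Fin n)) ^ (n + 1)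

/-! ### Bergman kernel, hyperbolic distance, Dirichlet domain -/

/-- `⟨z,w⟩ = z₁ w̄₁ + … + zₙ w̄ₙ - 1`. -/
def herm {n : ℕ} (z w : Ball n) : ℂ :=
  (∑ i, z.1 i * starRingEnd ℂ (w.1 i)) - 1

/-- The Bergman kernel of the ball with respect to Lebesgue measure. -/
def bergman {n : ℕ} (z w : Ball n) : ℂ :=
  ((n.factorial : ℂ) / (Real.pi : ℂ) ^ n) / (-herm z w) ^ (n + 1)

/-- The Bergman kernel on the diagonal, a positive real number. -/
def bergmanDiag {n : ℕ} (z : Ball n) : ℝ := (bergman z z).re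

/-- The constant `c(𝔹ⁿ,k)`, determined by
`c ∫ 𝒦(z,w)ᵏ 𝒦(w,z)ᵏ 𝒦(w,w)⁻ᵏ dV(w) = 𝒦(z,z)ᵏ` (taken at `z = 0`), with
`dV(w) = 𝒦(w,w) dV_e(w)` and `dV_e` the Lebesgue measure. -/
def repConst (n k : ℕ) : ℂ :=
  bergman (origin n) (origin n) ^ k /
    ∫ w : Ball n, bergman (origin n) w ^ k * bergman w (origin n) ^ k / bergman w w ^ k *
      bergman w w ∂(lebesgue n)

/-- The complex hyperbolic distance: `cosh² (τ(z,w)/2) = ⟨z,w⟩⟨w,z⟩ / (⟨z,z⟩⟨w,w⟩)`. -/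
def tau {n : ℕ} (z w : Ball n) : ℝ :=
  2 * Real.arcosh (Real.sqrt ((herm z w * herm w z) / (herm z z * herm w w)).re)

/-- `dist(A,B) = inf {τ(z,w) | z ∈ A, w ∈ B}`. -/
def setDist {n : ℕ} (A B : Set (Ball n)) : ℝ :=
  sInf {t | ∃ z ∈ A, ∃ w ∈ B, t = tau z w}

/-- The (closed) Dirichlet fundamental domain of `Γ` centred at `p₀`. -/
def dirichlet {n : ℕ} (Γ : Subgroup (SU n)) (p₀ : Ball n) : Set (Ball n) :=
  {z | ∀ γ : Γ, tau z p₀ ≤ tau z (γ • p₀)}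

/-- The ball quotient `M = Γ \ 𝔹ⁿ`, with the quotient topology. -/
abbrev BallQuot {n : ℕ} (Γ : Subgroup (SU n)) : Type := MulAction.orbitRel.Quotient Γ (Ball n)

/-- The projection `π : 𝔹ⁿ → M`. -/
def proj {n : ℕ} (Γ : Subgroup (SU n)) (z : Ball n) : BallQuot Γ := Quotient.mk _ z

/-- `Γ X`, the union of all translates of `X`. -/
def saturation {n : ℕ} (Γ : Subgroup (SU n)) (X : Set (Ball n)) : Set (Ball n) :=
  {w | ∃ γ : Γ, ∃ z ∈ X, w = γ • z}

/-! ### Submanifolds and integration of forms -/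

/-- A set `S` in `ℂⁿ = ℝ²ⁿ` as an embedded smooth submanifold (without boundary) of real
dimension `q`: near each of its points a local diffeomorphism of the ambient space flattens `S`
to a `q`-dimensional real subspace. -/
def IsSubmanifold {n : ℕ} (q : ℕ) (S : Set (EuclideanSpace ℂ (Fin n))) : Prop :=
  ∀ x ∈ S, ∃ (Φ : OpenPartialHomeomorph (EuclideanSpace ℂ (Fin n)) (EuclideanSpace ℂ (Fin n)))
    (W : Submodule ℝ (EuclideanSpace ℂ (Fin n))),
    x ∈ Φ.source ∧
    ContDiffOn ℝ (⊤ : ℕ∞) Φ Φ.source ∧ ContDiffOn ℝ (⊤ : ℕ∞) Φ.symm Φ.target ∧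
    Module.finrank ℝ W = q ∧
    Φ '' (S ∩ Φ.source) = (W : Set (EuclideanSpace ℂ (Fin n))) ∩ Φ.target

/-- A subset of the ball, viewed in `ℂⁿ`. -/
def ambient {n : ℕ} (X : Set (Ball n)) : Set (EuclideanSpace ℂ (Fin n)) := Subtype.val '' X

/-- Submanifolds of `M`. As `π` is a local diffeomorphism onto `M`, a subset of `M` is an embedded
submanifold exactly if its full preimage in the ball is one. -/
def IsSubmanifoldQuot {n : ℕ} (Γ : Subgroup (SU n)) (q : ℕ) (X' : Set (BallQuot Γ)) : Prop :=
  IsSubmanifold q (ambient (proj Γ ⁻¹' X'))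

/-- Fields of alternating real `q`-forms on `ℂⁿ = ℝ²ⁿ`. -/
abbrev FormField (n q : ℕ) : Type :=
  EuclideanSpace ℂ (Fin n) → EuclideanSpace ℂ (Fin n) [⋀^Fin q]→L[ℝ] ℝ

/-- The tangent space `T_x S`. -/
def tangent {n : ℕ} (S : Set (EuclideanSpace ℂ (Fin n))) (x : EuclideanSpace ℂ (Fin n)) :
    Submodule ℝ (EuclideanSpace ℂ (Fin n)) :=
  Submodule.span ℝ (tangentConeAt ℝ S x)

/-- The restriction of the form `ν x` to `T_x S`. -/
def restr {n q : ℕ} (S : Set (EuclideanSpace ℂ (Fin n))) (ν : FormField n q)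
    (x : EuclideanSpace ℂ (Fin n)) : (tangent S x) [⋀^Fin q]→L[ℝ] ℝ :=
  (ν x).compContinuousLinearMap (tangent S x).subtypeL

/-- `o` defines an orientation of the `q`-dimensional submanifold `S`: it is a continuous `q`-form
along `S` whose restriction to `S` vanishes nowhere; a frame is positive if `o` is positive
on it. -/
def IsOrientation {n q : ℕ} (S : Set (EuclideanSpace ℂ (Fin n))) (o : FormField n q) : Prop :=
  ContinuousOn o S ∧ ∀ x ∈ S, restr S o x ≠ 0

/-- `ν` defines a smooth `q`-form on `S`: it is smooth on an open neighbourhood of `S`. (Only its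
restriction to the tangent spaces of `S` matters; every smooth form on an embedded submanifold is
obtained so.) -/
def IsSmoothForm {n q : ℕ} (S : Set (EuclideanSpace ℂ (Fin n))) (ν : FormField n q) : Prop :=
  ∃ U : Set (EuclideanSpace ℂ (Fin n)), IsOpen U ∧ S ⊆ U ∧ ContDiffOn ℝ (⊤ : ℕ∞) ν U

open Classical in
/-- The value of the `q`-form `ν` on a positive orthonormal basis of `T_x S` (`dim S = q`), that is
the density of `ν` with respect to the Euclidean `q`-dimensional volume of `S`. Its absolute value
is the operator norm of `ν|_{T_x S}`, its sign tells whether `ν` and the orientation agree. -/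
def density {n q : ℕ} (S : Set (EuclideanSpace ℂ (Fin n))) (o ν : FormField n q)
    (x : EuclideanSpace ℂ (Fin n)) : ℝ :=
  (if ∃ v, 0 < restr S o x v ∧ 0 < restr S ν x v then 1 else -1) * ‖restr S ν x‖

/-- `∫_X f ν` for a `q`-form `ν` on the `q`-dimensional submanifold `X` oriented by `o`;
`μHE[q]` is the `q`-dimensional Euclidean volume. -/
def formIntegral {n q : ℕ} {V : Type*} [NormedAddCommGroup V] [NormedSpace ℝ V]
    (X : Set (Ball n)) (o ν : FormField n q) (f : Ball n → V) : V :=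
  ∫ x in X, density (ambient X) o ν (x : EuclideanSpace ℂ (Fin n)) • f x ∂μHE[q]

/-- `X` is a submanifold of the fundamental domain, of dimension `q > 0`, of the form
`X = π⁻¹(X') ∩ 𝓕` with `X'` a submanifold of `M` and `π : X → X'` one-to-one (hence a
diffeomorphism), oriented by `o`, and `ν` is a smooth real `q`-form on `X` that is absolutely
integrable and has positive integral. -/
structure IsSubmanifoldWithForm {n : ℕ} (Γ : Subgroup (SU n)) (p₀ : Ball n) (q : ℕ)
    (X' : Set (BallQuot Γ)) (X : Set (Ball n)) (o ν : FormField n q) : Prop where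
  dim_pos : 0 < q
  submanifold_quot : IsSubmanifoldQuot Γ q X'
  submanifold : IsSubmanifold q (ambient X)
  eq_inter : X = proj Γ ⁻¹' X' ∩ dirichlet Γ p₀
  bijOn : Set.BijOn (proj Γ) X X'
  orientation : IsOrientation (ambient X) o
  smooth : IsSmoothForm (ambient X) ν
  integrable : IntegrableOn
    (fun x : Ball n => density (ambient X) o ν (x : EuclideanSpace ℂ (Fin n))) X μHE[q]
  integral_pos : 0 < formIntegral X o ν fun _ => (1 : ℝ)

/-! ### Vector-valued Poincaré series -/

/-- `Θ_p^{(j;k)}(z) = c(𝔹ⁿ,k) ∑_{γ ∈ Γ} ρ(γ⁻¹) 𝒯_p(γ z) J(γ,z)ᵏ`, where the `j`-th component of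
`𝒯_p(z)` is `𝒦(z,p)ᵏ` and all others are zero. -/
def thetaPoint {n m : ℕ} (Γ : Subgroup (SU n)) (ρ : Γ →* Matrix.unitaryGroup (Fin m) ℂ)
    (j : Fin m) (k : ℕ) (p z : Ball n) : Fin m → ℂ :=
  repConst n k • ∑' γ : Γ,
    jac (γ : SU n) z ^ k •
      (ρ γ⁻¹ : Matrix (Fin m) (Fin m) ℂ).mulVec (Pi.single j (bergman (γ • z) p ^ k))

/-- `Θ_X^{(j;k)}(z) = ∫_X Θ_p^{(j;k)}(z) 𝒦(p,p)^{-k/2} ν(p)`. -/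
def thetaSub {n m q : ℕ} (Γ : Subgroup (SU n)) (ρ : Γ →* Matrix.unitaryGroup (Fin m) ℂ)
    (X : Set (Ball n)) (o ν : FormField n q) (j : Fin m) (k : ℕ) (z : Ball n) : Fin m → ℂ :=
  formIntegral X o ν fun p => (bergmanDiag p ^ (-(k : ℝ) / 2)) • thetaPoint Γ ρ j k p z

/-- The inner product `(F,G) = ∫_{Γ \ 𝔹ⁿ} F(z)ᵀ conj(G(z)) 𝒦(z,z)⁻ᵏ dV(z)` of forms of weight `k`,
where `dV(z) = 𝒦(z,z) dV_e(z)`; the integral over the quotient is the integral over the Dirichlet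
fundamental domain. -/
def petersson {n m : ℕ} (Γ : Subgroup (SU n)) (p₀ : Ball n) (k : ℕ) (F G : Ball n → Fin m → ℂ) :
    ℂ :=
  ∫ z in dirichlet Γ p₀,
    (∑ i, F z i * starRingEnd ℂ (G z i)) * ((bergmanDiag z)⁻¹ ^ k * bergmanDiag z : ℝ)
      ∂(lebesgue n)

end BallQuotient

end

/-!
The pairing of `Θ_X^{(r;k)}(z)` and `Θ_Y^{(j;k)}(z)` is a double orbit sum over `γ, γ' ∈ Γ`, whose
`(γ, γ')` term carries the matrix entry `(j, r)` of `ρ(γ' γ⁻¹)` and, up to the weight `𝒦(z,z)ᵏ`, has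
modulus `(cosh (τ(γz,p)/2) cosh (τ(γ'z,q)/2))^(-(n+1)k)`. By the triangle inequality through `γ'z`,
the product of the two `cosh` is at least `cosh² (δ/4)` when `τ(γ'γ⁻¹p, q) ≥ δ`. The remaining pairs
have `γ'γ⁻¹p ∈ X`, hence `γ'γ⁻¹p = p` because `π` is injective on `X`; then `ρ(γ'γ⁻¹) = 1` and its
off-diagonal entries vanish. A fixed power `N` of the `cosh` factors is kept aside to make the orbit
sums converge uniformly on bounded sets. Since `c(𝔹ⁿ,k)` grows slower than `yᵏ` for every `y > 1`,
the decay in `k` is exponential.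
-/

noncomputable section

namespace BallQuotient

/-! ### The hyperbolic distance -/

section Distance

variable {n : ℕ}

/-- The boundary defining function `√(-⟨z,z⟩)` of the ball. It turns the formula for `τ` into
`cosh (τ(z,w)/2) = |⟨z,w⟩| / (defect z * defect w)`. -/
def defect (z : Ball n) : ℝ := √(1 - ‖z.1‖ ^ 2)

theorem one_sub_norm_sq_pos (z : Ball n) : 0 < 1 - ‖z.1‖ ^ 2 := by
  nlinarith [norm_nonneg z.1, z.2]

theorem defect_pos (z : Ball n) : 0 < defect z := Real.sqrt_pos.2 (one_sub_norm_sq_pos z)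

theorem defect_sq (z : Ball n) : defect z ^ 2 = 1 - ‖z.1‖ ^ 2 :=
  Real.sq_sqrt (one_sub_norm_sq_pos z).le

theorem defect_origin : defect (origin n) = 1 := by simp [defect, origin]

theorem herm_eq_inner (z w : Ball n) : herm z w = inner ℂ w.1 z.1 - 1 := by
  simp [herm, PiLp.inner_apply]

theorem herm_self (z : Ball n) : herm z z = -(defect z ^ 2 : ℝ) := by
  rw [herm_eq_inner, inner_self_eq_norm_sq_to_K, defect_sq]
  push_cast
  simp

theorem norm_herm_self (z : Ball n) : ‖herm z z‖ = defect z ^ 2 := by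
  rw [herm_self, norm_neg, Complex.norm_real, Real.norm_of_nonneg (sq_nonneg _)]

theorem herm_origin_right (z : Ball n) : herm z (origin n) = -1 := by simp [herm, origin]

theorem herm_conj (z w : Ball n) : starRingEnd ℂ (herm z w) = herm w z := by
  simp [herm_eq_inner]

theorem norm_herm_comm (z w : Ball n) : ‖herm z w‖ = ‖herm w z‖ := by
  rw [← herm_conj, RCLike.norm_conj]

/-- The hermitian form `⟨u,z⟩⟨z,v⟩ - ⟨u,v⟩⟨z,z⟩` in `u` and `v` is positive semidefinite. -/
theorem herm_mul_herm_sub (z u v : Ball n) :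
    herm u z * herm z v - herm u v * herm z z =
      ((defect z ^ 2 : ℝ) : ℂ) * inner ℂ (v.1 - z.1) (u.1 - z.1) +
        inner ℂ z.1 (u.1 - z.1) * inner ℂ (v.1 - z.1) z.1 := by
  have hz : ((‖z.1‖ ^ 2 : ℝ) : ℂ) = inner ℂ z.1 z.1 := by
    rw [inner_self_eq_norm_sq_to_K]
    push_cast
    rfl
  simp only [defect_sq, herm_eq_inner, inner_sub_left, inner_sub_right, Complex.ofReal_sub, hz,
    Complex.ofReal_one]
  ring

theorem norm_herm_sq_sub (z u : Ball n) :
    ‖herm u z‖ ^ 2 - (defect u * defect z) ^ 2 =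
      defect z ^ 2 * ‖u.1 - z.1‖ ^ 2 + ‖inner ℂ z.1 (u.1 - z.1)‖ ^ 2 := by
  have h := herm_mul_herm_sub z u u
  rw [← herm_conj u z, Complex.mul_conj', herm_self, herm_self,
    ← inner_conj_symm (u.1 - z.1) z.1, Complex.mul_conj', inner_self_eq_norm_sq_to_K] at h
  apply Complex.ofReal_injective
  push_cast at h ⊢
  linear_combination h

theorem norm_herm_mul_herm_sub_sq_le (z u v : Ball n) :
    ‖herm u z * herm z v - herm u v * herm z z‖ ^ 2 ≤
      (‖herm u z‖ ^ 2 - (defect u * defect z) ^ 2) *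
        (‖herm v z‖ ^ 2 - (defect v * defect z) ^ 2) := by
  rw [norm_herm_sq_sub, norm_herm_sq_sub, herm_mul_herm_sub]
  have cauchy_schwarz (s a b c d : ℝ) :
      (s ^ 2 * (a * b) + c * d) ^ 2 ≤ (s ^ 2 * a ^ 2 + c ^ 2) * (s ^ 2 * b ^ 2 + d ^ 2) := by
    nlinarith [sq_nonneg (s * a * d - s * b * c)]
  refine le_trans ?_ (cauchy_schwarz _ _ _ _ _)
  gcongr
  refine (norm_add_le _ _).trans ?_
  rw [norm_mul, norm_mul, Complex.norm_real, Real.norm_of_nonneg (sq_nonneg _),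
    norm_inner_symm (v.1 - z.1) z.1, mul_comm ‖u.1 - z.1‖]
  gcongr
  exact norm_inner_le_norm _ _

theorem defect_mul_defect_le_norm_herm (z w : Ball n) : defect z * defect w ≤ ‖herm z w‖ := by
  refine le_of_sq_le_sq ?_ (norm_nonneg _)
  have := norm_herm_sq_sub w z
  have : 0 ≤ defect w ^ 2 * ‖z.1 - w.1‖ ^ 2 + ‖inner ℂ w.1 (z.1 - w.1)‖ ^ 2 := by positivity
  linarith

theorem tau_eq (z w : Ball n) :
    tau z w = 2 * Real.arcosh (‖herm z w‖ / (defect z * defect w)) := by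
  have hratio : herm z w * herm w z / (herm z z * herm w w) =
      (((‖herm z w‖ / (defect z * defect w)) ^ 2 : ℝ) : ℂ) := by
    rw [← herm_conj z w, Complex.mul_conj', herm_self, herm_self]
    push_cast
    ring
  have := defect_pos z
  have := defect_pos w
  rw [tau, hratio, Complex.ofReal_re, Real.sqrt_sq (by positivity)]

theorem cosh_half_tau (z w : Ball n) :
    Real.cosh (tau z w / 2) = ‖herm z w‖ / (defect z * defect w) := by
  rw [tau_eq, mul_div_cancel_left₀ _ two_ne_zero, Real.cosh_arcosh]
  rw [one_le_div (mul_pos (defect_pos z) (defect_pos w))]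
  exact defect_mul_defect_le_norm_herm z w

theorem cosh_half_tau_origin (z : Ball n) :
    Real.cosh (tau z (origin n) / 2) = (defect z)⁻¹ := by
  simp [cosh_half_tau, herm_origin_right, defect_origin]

theorem norm_herm_eq (z w : Ball n) :
    ‖herm z w‖ = defect z * defect w * Real.cosh (tau z w / 2) := by
  rw [cosh_half_tau, mul_div_cancel₀ _ (mul_pos (defect_pos z) (defect_pos w)).ne']

theorem tau_nonneg (z w : Ball n) : 0 ≤ tau z w := by
  rw [tau_eq]
  refine mul_nonneg two_pos.le (Real.arcosh_nonneg ?_)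
  rw [one_le_div (mul_pos (defect_pos z) (defect_pos w))]
  exact defect_mul_defect_le_norm_herm z w

theorem tau_comm (z w : Ball n) : tau z w = tau w z := by
  rw [tau_eq, tau_eq, norm_herm_comm, mul_comm (defect z)]

theorem cosh_half_le_cosh_half {s t : ℝ} (hs : 0 ≤ s) (hst : s ≤ t) :
    Real.cosh (s / 2) ≤ Real.cosh (t / 2) := by
  rw [Real.cosh_le_cosh, abs_of_nonneg, abs_of_nonneg] <;> linarith

theorem norm_herm_sq_sub_eq_sinh (z u : Ball n) :
    ‖herm u z‖ ^ 2 - (defect u * defect z) ^ 2 =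
      (defect u * defect z * Real.sinh (tau u z / 2)) ^ 2 := by
  rw [norm_herm_eq, mul_pow _ (Real.cosh _), mul_pow _ (Real.sinh _), Real.cosh_sq]
  ring

theorem tau_triangle (u z v : Ball n) : tau u v ≤ tau u z + tau z v := by
  have hu := defect_pos u
  have hz := defect_pos z
  have hv := defect_pos v
  have huz := tau_nonneg u z
  have hzv := tau_nonneg z v
  have hsub : ‖herm u z * herm z v - herm u v * herm z z‖ ≤
      defect u * defect z * Real.sinh (tau u z / 2) *
        (defect v * defect z * Real.sinh (tau z v / 2)) := by
    refine le_of_sq_le_sq ?_ ?_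
    · rw [mul_pow, tau_comm z v, ← norm_herm_sq_sub_eq_sinh, ← norm_herm_sq_sub_eq_sinh]
      exact norm_herm_mul_herm_sub_sq_le z u v
    · have := Real.sinh_nonneg_iff.2 (show 0 ≤ tau u z / 2 by positivity)
      have := Real.sinh_nonneg_iff.2 (show 0 ≤ tau z v / 2 by positivity)
      positivity
  have hcosh : Real.cosh (tau u v / 2) ≤ Real.cosh (tau u z / 2 + tau z v / 2) := by
    have h := norm_le_norm_add_norm_sub (herm u z * herm z v) (herm u v * herm z z)
    rw [norm_mul, norm_mul, norm_herm_self, norm_herm_eq u v, norm_herm_eq u z,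
      norm_herm_eq z v] at h
    refine le_of_mul_le_mul_left ?_ (show 0 < defect u * defect v * defect z ^ 2 by positivity)
    rw [Real.cosh_add]
    linarith
  rw [Real.cosh_le_cosh, abs_of_nonneg (by linarith [tau_nonneg u v]),
    abs_of_nonneg (by linarith)] at hcosh
  linarith

theorem setDist_le {A B : Set (Ball n)} {z w : Ball n} (hz : z ∈ A) (hw : w ∈ B) :
    setDist A B ≤ tau z w := by
  refine csInf_le ⟨0, ?_⟩ ⟨z, hz, w, hw, rfl⟩
  rintro t ⟨z, -, w, -, rfl⟩
  exact tau_nonneg z w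

theorem cosh_half_add_le (s t : ℝ) :
    Real.cosh ((s + t) / 2) ≤ 2 * (Real.cosh (s / 2) * Real.cosh (t / 2)) := by
  have h := Real.cosh_pos ((s - t) / 2)
  rw [sub_div, Real.cosh_sub] at h
  rw [add_div, Real.cosh_add]
  linarith

theorem cosh_quarter_add_sq_le (s t : ℝ) :
    Real.cosh ((s + t) / 4) ^ 2 ≤ Real.cosh (s / 2) * Real.cosh (t / 2) := by
  have hprod : 2 * (Real.cosh (s / 2) * Real.cosh (t / 2)) =
      Real.cosh ((s + t) / 2) + Real.cosh ((s - t) / 2) := by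
    rw [add_div, sub_div, Real.cosh_add, Real.cosh_sub]
    ring
  have hdouble : Real.cosh ((s + t) / 2) = 2 * Real.cosh ((s + t) / 4) ^ 2 - 1 := by
    rw [show (s + t) / 2 = 2 * ((s + t) / 4) by ring, Real.cosh_two_mul, Real.sinh_sq]
    ring
  linarith [Real.one_le_cosh ((s - t) / 2)]

end Distance

/-! ### The action of `SU(n,1)` -/

section Action

variable {n : ℕ}

theorem dot_sig_conj (v w : Fin (n + 1) → ℂ) :
    v ⬝ᵥ (sig n).mulVec (fun i => starRingEnd ℂ (w i)) =
      (∑ i : Fin n, v i.castSucc * starRingEnd ℂ (w i.castSucc)) -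
        v (Fin.last n) * starRingEnd ℂ (w (Fin.last n)) := by
  simp [sig, dotProduct, Matrix.mulVec_diagonal, Fin.sum_univ_castSucc, sub_eq_add_neg]

theorem num_dot_sig_num (A : SU n) (z w : EuclideanSpace ℂ (Fin n)) :
    num A z ⬝ᵥ (sig n).mulVec (fun i => starRingEnd ℂ (num A w i)) =
      homog z ⬝ᵥ (sig n).mulVec (fun i => starRingEnd ℂ (homog w i)) := by
  have hA : (A : Matrix.SpecialLinearGroup (Fin (n + 1)) ℂ).1.transpose * sig n *
      (A : Matrix.SpecialLinearGroup (Fin (n + 1)) ℂ).1.map (starRingEnd ℂ) = sig n := A.2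
  have hconj : (fun i => starRingEnd ℂ (num A w i)) =
      ((A : Matrix.SpecialLinearGroup (Fin (n + 1)) ℂ).1.map (starRingEnd ℂ)).mulVec
        (fun i => starRingEnd ℂ (homog w i)) := by
    funext i
    simp [num, Matrix.mulVec, dotProduct]
  rw [hconj]
  conv_rhs => rw [← hA]
  rw [← Matrix.mulVec_mulVec, ← Matrix.mulVec_mulVec, Matrix.dotProduct_mulVec (homog z),
    Matrix.vecMul_transpose]
  rfl

theorem smul_val (A : SU n) (z : Ball n) : (A • z).1 = act A z.1 := rfl

theorem herm_smul_smul (A : SU n) (z w : Ball n) :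
    herm (A • z) (A • w) * (den A z.1 * starRingEnd ℂ (den A w.1)) = herm z w := by
  have hform := num_dot_sig_num A z.1 w.1
  have hz := den_ne_zero A z.2
  have hw := den_ne_zero A w.2
  have hw' : starRingEnd ℂ (den A w.1) ≠ 0 := by simpa only [ne_eq, map_eq_zero]
  have hherm : herm z w = ∑ i : Fin n, homog z.1 i.castSucc * starRingEnd ℂ (homog w.1 i.castSucc) -
      homog z.1 (Fin.last n) * starRingEnd ℂ (homog w.1 (Fin.last n)) := by
    simp [herm, homog]
  rw [hherm, ← dot_sig_conj, ← hform, dot_sig_conj, herm, sub_mul, Finset.sum_mul, one_mul]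
  congr 1
  refine Finset.sum_congr rfl fun i _ => ?_
  simp only [smul_val, act, map_div₀]
  field_simp

theorem defect_smul_mul_norm_den (A : SU n) (z : Ball n) :
    defect (A • z) * ‖den A z.1‖ = defect z := by
  have h := congrArg norm (herm_smul_smul A z z)
  rw [norm_mul, norm_mul, RCLike.norm_conj, norm_herm_self, norm_herm_self, ← sq, ← mul_pow] at h
  exact (pow_left_inj₀ (mul_nonneg (defect_pos _).le (norm_nonneg _)) (defect_pos z).le
    two_ne_zero).1 h

theorem tau_smul_smul (A : SU n) (z w : Ball n) : tau (A • z) (A • w) = tau z w := by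
  have hz := norm_pos_iff.2 (den_ne_zero A z.2)
  have hw := norm_pos_iff.2 (den_ne_zero A w.2)
  have := defect_pos (A • z)
  have := defect_pos (A • w)
  rw [tau_eq, tau_eq, ← herm_smul_smul A z w, ← defect_smul_mul_norm_den A z,
    ← defect_smul_mul_norm_den A w, norm_mul, norm_mul, RCLike.norm_conj]
  congr 2
  field_simp

theorem continuous_num (A : SU n) : Continuous (num A) := by
  refine Continuous.matrix_mulVec continuous_const (continuous_pi fun i => ?_)
  refine Fin.lastCases ?_ (fun i => ?_) i
  · simpa only [homog, Fin.snoc_last] using continuous_const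
  · simpa only [homog, Fin.snoc_castSucc] using PiLp.continuous_apply 2 _ i

instance (Γ : Subgroup (SU n)) : ContinuousConstSMul Γ (Ball n) where
  continuous_const_smul γ := by
    refine Continuous.subtype_mk ((PiLp.continuous_toLp 2 _).comp (continuous_pi fun i => ?_)) _
    refine Continuous.div ?_ ?_ fun z => den_ne_zero _ z.2
    · exact ((continuous_apply _).comp (continuous_num γ.1)).comp continuous_subtype_val
    · exact ((continuous_apply _).comp (continuous_num γ.1)).comp continuous_subtype_val

end Action

section Dirichlet

variable {n : ℕ}

theorem tau_inv_smul_right (A : SU n) (z w : Ball n) : tau z (A⁻¹ • w) = tau (A • z) w := by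
  rw [← tau_smul_smul A, smul_inv_smul]

theorem continuous_tau_left (w : Ball n) : Continuous fun z => tau z w := by
  have hherm : Continuous fun z : Ball n => ‖herm z w‖ := by
    simp only [herm_eq_inner]
    fun_prop
  have hdefect : Continuous fun z : Ball n => defect z * defect w := by
    unfold defect
    fun_prop
  simp only [tau_eq]
  refine continuous_const.mul (Real.continuousOn_arcosh.comp_continuous
    (hherm.div hdefect fun z => (mul_pos (defect_pos z) (defect_pos w)).ne') fun z => ?_)
  rw [Set.mem_Ici, one_le_div (mul_pos (defect_pos z) (defect_pos w))]
  exact defect_mul_defect_le_norm_herm z w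

theorem exists_tau_smul_origin_lt (Γ : Subgroup (SU n)) [CompactSpace (BallQuot Γ)] :
    ∃ T : ℝ, ∀ z : Ball n, ∃ γ : Γ, tau (γ • z) (origin n) < T := by
  have hopen : IsOpenMap (proj Γ) := isOpenMap_quotient_mk'_mul
  obtain ⟨m, hm⟩ := isCompact_univ.elim_directed_cover
    (fun m : ℕ => proj Γ '' {z | tau z (origin n) < m})
    (fun m => hopen _ (isOpen_lt (continuous_tau_left _) continuous_const))
    (fun x _ => by
      induction x using Quotient.inductionOn with | _ z =>
      obtain ⟨m, hm⟩ := exists_nat_gt (tau z (origin n))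
      exact Set.mem_iUnion.2 ⟨m, z, hm, rfl⟩)
    (Monotone.directed_le fun a b hab =>
      Set.image_mono fun z (hz : tau z (origin n) < a) => hz.trans_le (Nat.cast_le.2 hab))
  refine ⟨m, fun z => ?_⟩
  obtain ⟨w, hw, hwz⟩ := hm (Set.mem_univ (proj Γ z))
  obtain ⟨γ, rfl⟩ : w ∈ MulAction.orbit Γ z := Quotient.exact hwz
  exact ⟨γ, hw⟩

theorem exists_tau_origin_le_of_mem_dirichlet (Γ : Subgroup (SU n)) [CompactSpace (BallQuot Γ)]
    (p₀ : Ball n) : ∃ T : ℝ, ∀ z ∈ dirichlet Γ p₀, tau z (origin n) ≤ T := by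
  obtain ⟨T, hT⟩ := exists_tau_smul_origin_lt Γ
  refine ⟨T + tau (origin n) p₀ + tau p₀ (origin n), fun z hz => ?_⟩
  obtain ⟨γ, hγ⟩ := hT z
  calc tau z (origin n) ≤ tau z p₀ + tau p₀ (origin n) := tau_triangle _ _ _
    _ ≤ tau z (γ⁻¹ • p₀) + tau p₀ (origin n) := by gcongr; exact hz γ⁻¹
    _ = tau (γ • z) p₀ + tau p₀ (origin n) := by
      rw [show tau z (γ⁻¹ • p₀) = tau (γ • z) p₀ from tau_inv_smul_right γ.1 z p₀]
    _ ≤ tau (γ • z) (origin n) + tau (origin n) p₀ + tau p₀ (origin n) := by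
      gcongr
      exact tau_triangle _ _ _
    _ ≤ _ := by gcongr

end Dirichlet

/-! ### Growth of the orbits -/

section Frobenius

open scoped Matrix Matrix.Norms.Frobenius

variable {n : ℕ}

/-- The matrix underlying an element of `SU(n,1)`, normed by the Frobenius norm. -/
abbrev mat (A : SU n) : Matrix (Fin (n + 1)) (Fin (n + 1)) ℂ := A.1.1

theorem mat_mul (A B : SU n) : mat (A * B) = mat A * mat B := rfl

theorem sig_mul_sig : sig n * sig n = 1 := by
  rw [sig, Matrix.diagonal_mul_diagonal, ← Matrix.diagonal_one]
  congr 1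
  funext i
  refine Fin.lastCases ?_ (fun i => ?_) i <;> simp

theorem conjTranspose_mul_sig_mul (A : SU n) : (mat A)ᴴ * sig n * mat A = sig n := by
  have hA : (mat A)ᵀ * sig n * (mat A).map (starRingEnd ℂ) = sig n := A.2
  have hsig : (sig n)ᵀ = sig n := Matrix.diagonal_transpose _
  have h := congrArg Matrix.transpose hA
  rwa [Matrix.transpose_mul, Matrix.transpose_mul, hsig, Matrix.transpose_transpose,
    ← Matrix.mul_assoc] at h

theorem mat_inv (A : SU n) : mat A⁻¹ = sig n * (mat A)ᴴ * sig n := by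
  refine (left_inv_eq_right_inv (a := mat A) ?_ ?_).symm
  · rw [Matrix.mul_assoc, Matrix.mul_assoc, ← Matrix.mul_assoc _ (sig n),
      conjTranspose_mul_sig_mul, sig_mul_sig]
  · rw [← mat_mul, mul_inv_cancel]
    rfl

theorem norm_mat_inv_apply (A : SU n) (i j : Fin (n + 1)) : ‖mat A⁻¹ i j‖ = ‖mat A j i‖ := by
  have hsign (i : Fin (n + 1)) :
      ‖Fin.snoc (α := fun _ => ℂ) (fun _ : Fin n => (1 : ℂ)) (-1) i‖ = 1 := by
    refine Fin.lastCases ?_ (fun i => ?_) i <;> simp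
  rw [mat_inv, sig, Matrix.mul_diagonal, Matrix.diagonal_mul, norm_mul, norm_mul, hsign, hsign,
    one_mul, mul_one, Matrix.conjTranspose_apply, norm_star]

theorem norm_mat_inv (A : SU n) : ‖mat A⁻¹‖ = ‖mat A‖ := by
  rw [Matrix.frobenius_norm_def, Matrix.frobenius_norm_def, Finset.sum_comm]
  simp only [norm_mat_inv_apply]

theorem sum_norm_mat_sq (A : SU n) (i : Fin (n + 1)) :
    ∑ k : Fin n, ‖mat A i k.castSucc‖ ^ 2 = ‖mat A i (Fin.last n)‖ ^ 2 + (sig n i i).re := by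
  have h := congrArg Complex.re (congrFun (congrFun (conjTranspose_mul_sig_mul A⁻¹) i) i)
  have hre (z : ℂ) : (star z * z).re = ‖z‖ ^ 2 := by
    rw [Complex.star_def, Complex.conj_mul', ← Complex.ofReal_pow, Complex.ofReal_re]
  rw [Matrix.mul_apply, Fin.sum_univ_castSucc] at h
  simp only [sig, Matrix.mul_diagonal, Matrix.conjTranspose_apply, Fin.snoc_castSucc,
    Fin.snoc_last, mul_one, mul_neg_one, neg_mul, Complex.add_re, Complex.re_sum, Complex.neg_re,
    hre, norm_mat_inv_apply] at h
  rw [sig]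
  linarith

theorem sum_norm_mat_last_sq (A : SU n) :
    ∑ k : Fin n, ‖mat A k.castSucc (Fin.last n)‖ ^ 2 =
      ‖mat A (Fin.last n) (Fin.last n)‖ ^ 2 - 1 := by
  have h := sum_norm_mat_sq A⁻¹ (Fin.last n)
  simp only [norm_mat_inv_apply] at h
  rw [h, sig, Matrix.diagonal_apply_eq, Fin.snoc_last, Complex.neg_re, Complex.one_re,
    sub_eq_add_neg]

theorem norm_mat_sq (A : SU n) :
    ‖mat A‖ ^ 2 = 4 * ‖mat A (Fin.last n) (Fin.last n)‖ ^ 2 + n - 3 := by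
  have hnorm : ‖mat A‖ ^ 2 = ∑ i, ∑ j, ‖mat A i j‖ ^ 2 := by
    rw [Matrix.frobenius_norm_def, ← Real.sqrt_eq_rpow, Real.sq_sqrt (by positivity)]
    simp only [Real.rpow_two]
  have hrow (i : Fin (n + 1)) :
      ∑ j, ‖mat A i j‖ ^ 2 = 2 * ‖mat A i (Fin.last n)‖ ^ 2 + (sig n i i).re := by
    rw [Fin.sum_univ_castSucc, sum_norm_mat_sq]
    ring
  have htrace : ∑ i, (sig n i i).re = n - 1 := by
    simp [sig, Fin.sum_univ_castSucc, sub_eq_add_neg]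
  rw [hnorm, Finset.sum_congr rfl fun i _ => hrow i, Finset.sum_add_distrib, htrace,
    ← Finset.mul_sum, Fin.sum_univ_castSucc, sum_norm_mat_last_sq]
  ring

theorem norm_mat_last_last (A : SU n) :
    ‖mat A (Fin.last n) (Fin.last n)‖ = Real.cosh (tau (A • origin n) (origin n) / 2) := by
  have hden : den A (origin n).1 = mat A (Fin.last n) (Fin.last n) := by
    simp [den, num, homog, origin, Matrix.mulVec, dotProduct, Fin.sum_univ_castSucc]
  have h := defect_smul_mul_norm_den A (origin n)
  rw [defect_origin, hden] at h
  rw [cosh_half_tau_origin]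
  exact eq_inv_of_mul_eq_one_right h

theorem one_add_norm_mat_le (A : SU n) :
    1 + ‖mat A‖ ≤ (n + 5) * Real.cosh (tau (A • origin n) (origin n) / 2) := by
  have hsq := norm_mat_sq A
  rw [norm_mat_last_last] at hsq
  set t := Real.cosh (tau (A • origin n) (origin n) / 2)
  have ht : 1 ≤ t := Real.one_le_cosh _
  have : ‖mat A‖ ≤ (n + 4) * t := by
    refine le_of_sq_le_sq ?_ (by positivity)
    have : 1 ≤ t ^ 2 := one_le_pow₀ ht
    have : (n : ℝ) ≤ n * t ^ 2 := le_mul_of_one_le_right n.cast_nonneg this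
    have : 0 ≤ (n : ℝ) ^ 2 * t ^ 2 := by positivity
    nlinarith
  linarith

theorem one_add_norm_mat_le_of_tau_le (A : SU n) {z p : Ball n} {T : ℝ}
    (hz : tau z (origin n) ≤ T) (hp : tau p (origin n) ≤ T) :
    1 + ‖mat A‖ ≤ 2 * (n + 5) * Real.cosh T * Real.cosh (tau (A • z) p / 2) := by
  have htau : tau (A • origin n) (origin n) ≤ 2 * T + tau (A • z) p := by
    have h₁ := tau_triangle (A • origin n) (A • z) (origin n)
    have h₂ := tau_triangle (A • z) p (origin n)
    rw [tau_smul_smul, tau_comm (origin n)] at h₁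
    linarith
  calc 1 + ‖mat A‖ ≤ (n + 5) * Real.cosh (tau (A • origin n) (origin n) / 2) :=
        one_add_norm_mat_le A
    _ ≤ (n + 5) * Real.cosh ((2 * T + tau (A • z) p) / 2) := by
        gcongr
        exact cosh_half_le_cosh_half (tau_nonneg _ _) htau
    _ ≤ (n + 5) * (2 * (Real.cosh (2 * T / 2) * Real.cosh (tau (A • z) p / 2))) := by
        gcongr
        exact cosh_half_add_le _ _
    _ = _ := by
        rw [mul_div_cancel_left₀ T two_ne_zero]
        ring

theorem norm_mat_inv_mul_sub_one_le (A B : SU n) :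
    ‖mat (A⁻¹ * B) - 1‖ ≤ ‖mat A‖ * ‖mat A - mat B‖ := by
  have hone : mat A⁻¹ * mat A = 1 := by rw [← mat_mul, inv_mul_cancel]; rfl
  rw [mat_mul, ← hone, ← mul_sub, ← norm_mat_inv A, norm_sub_rev (mat A)]
  exact norm_mul_le _ _

theorem exists_le_norm_mat_sub (Γ : Subgroup (SU n)) [DiscreteTopology Γ] :
    ∃ ε : ℝ, 0 < ε ∧ ∀ γ γ' : Γ, γ ≠ γ' →
      ε ≤ ‖mat γ.1 - mat γ'.1‖ * (1 + ‖mat γ.1‖) := by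
  have hmat : Topology.IsInducing fun γ : Γ => mat γ.1 :=
    Topology.IsInducing.subtypeVal.comp
      (Topology.IsInducing.subtypeVal.comp Topology.IsInducing.subtypeVal)
  have hone : ({1} : Set Γ) ∈ nhds (1 : Γ) := (isOpen_discrete _).mem_nhds rfl
  rw [hmat.nhds_eq_comap] at hone
  obtain ⟨U, hU, hUone⟩ := hone
  obtain ⟨ε, hε, hball⟩ := Metric.mem_nhds_iff.1 hU
  have hsep (γ : Γ) (hγ : γ ≠ 1) : ε ≤ ‖mat γ.1 - 1‖ := by
    by_contra! h
    exact hγ (hUone (hball (mem_ball_iff_norm.2 h)))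
  refine ⟨ε, hε, fun γ γ' hne => ?_⟩
  calc ε ≤ ‖mat (γ⁻¹ * γ').1 - 1‖ := hsep _ (by rwa [ne_eq, inv_mul_eq_one])
    _ ≤ ‖mat γ.1‖ * ‖mat γ.1 - mat γ'.1‖ := norm_mat_inv_mul_sub_one_le γ.1 γ'.1
    _ ≤ ‖mat γ.1 - mat γ'.1‖ * (1 + ‖mat γ.1‖) := by
      rw [mul_comm]
      gcongr
      exact le_add_of_nonneg_left zero_le_one

end Frobenius

section Separated

open Module

theorem summable_setIntegral_of_pairwise_disjoint {α ι : Type*} [MeasurableSpace α]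
    {μ : Measure α} {g : α → ℝ} (hg : Integrable g μ) (hg0 : 0 ≤ g) {s : ι → Set α}
    (hs : ∀ i, MeasurableSet (s i)) (hd : Pairwise (Function.onFun Disjoint s)) :
    Summable fun i => ∫ x in s i, g x ∂μ := by
  refine summable_of_sum_le (c := ∫ x, g x ∂μ) (fun i => integral_nonneg hg0) fun t => ?_
  rw [← integral_biUnion_finset t (fun i _ => hs i) (fun i _ j _ hij => hd hij)
    fun i _ => hg.integrableOn]
  exact setIntegral_le_integral hg (Filter.Eventually.of_forall hg0)

theorem exists_mul_inv_pow_le_setIntegral_ball {E : Type*} [NormedAddCommGroup E]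
    [NormedSpace ℝ E] [FiniteDimensional ℝ E] [MeasurableSpace E] [BorelSpace E] (μ : Measure E)
    [μ.IsAddHaarMeasure] {s : ℝ} (hs : 0 < s) :
    ∃ c : ℝ, 0 < c ∧ ∀ x : E, c * (1 + ‖x‖)⁻¹ ^ (2 * finrank ℝ E + 1) ≤
      ∫ y in Metric.ball x (s * (1 + ‖x‖)⁻¹), (1 + ‖y‖) ^ (-((finrank ℝ E : ℝ) + 1)) ∂μ := by
  set d := finrank ℝ E
  have hball : 0 < μ.real (Metric.ball (0 : E) 1) :=
    ENNReal.toReal_pos (Metric.measure_ball_pos μ _ one_pos).ne' measure_ball_lt_top.ne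
  refine ⟨(1 + s)⁻¹ ^ (d + 1) * (s ^ d * μ.real (Metric.ball 0 1)), by positivity, fun x => ?_⟩
  have hr : 0 < s * (1 + ‖x‖)⁻¹ := by positivity
  have hlow : ∀ y ∈ Metric.ball x (s * (1 + ‖x‖)⁻¹),
      ((1 + s)⁻¹ * (1 + ‖x‖)⁻¹) ^ (d + 1) ≤ (1 + ‖y‖) ^ (-((d : ℝ) + 1)) := by
    intro y hy
    have hy' : ‖y‖ ≤ ‖x‖ + s := by
      have : s * (1 + ‖x‖)⁻¹ ≤ s :=
        mul_le_of_le_one_right hs.le (inv_le_one_of_one_le₀ (by linarith [norm_nonneg x]))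
      linarith [norm_sub_norm_le y x, mem_ball_iff_norm.1 hy]
    rw [Real.rpow_neg (by positivity), ← Nat.cast_succ, Real.rpow_natCast, ← inv_pow, ← mul_inv]
    gcongr
    nlinarith [norm_nonneg x]
  have hvol : μ.real (Metric.ball x (s * (1 + ‖x‖)⁻¹)) =
      (s * (1 + ‖x‖)⁻¹) ^ d * μ.real (Metric.ball 0 1) := by
    rw [Measure.real, Measure.addHaar_ball_of_pos μ _ hr, ENNReal.toReal_mul,
      ENNReal.toReal_ofReal (by positivity), Measure.real]
  refine le_trans (le_of_eq ?_) (setIntegral_ge_of_const_le_real measurableSet_ball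
    measure_ball_lt_top.ne hlow (integrable_one_add_norm (by simp [d])).integrableOn)
  rw [hvol]
  ring

/-- Half of the separation is the radius of pairwise disjoint balls, over which
`(1 + ‖x‖) ^ (-(dim E + 1))` is integrable. -/
theorem summable_one_add_norm_inv_pow_of_separated {E ι : Type*} [NormedAddCommGroup E]
    [NormedSpace ℝ E] [FiniteDimensional ℝ E] {f : ι → E} {ε : ℝ} (hε : 0 < ε)
    (hsep : ∀ i j, i ≠ j → ε ≤ ‖f i - f j‖ * (1 + ‖f i‖)) :
    Summable fun i => (1 + ‖f i‖)⁻¹ ^ (2 * finrank ℝ E + 1) := by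
  borelize E
  have := FiniteDimensional.proper_real E
  obtain ⟨c, hc, hlow⟩ :=
    exists_mul_inv_pow_le_setIntegral_ball (Measure.addHaar : Measure E) (half_pos hε)
  have hdisj : Pairwise (Function.onFun Disjoint
      fun i => Metric.ball (f i) (ε / 2 * (1 + ‖f i‖)⁻¹)) := by
    intro i j hij
    refine Metric.ball_disjoint_ball ?_
    have hi : ε * (1 + ‖f i‖)⁻¹ ≤ ‖f i - f j‖ := by
      rw [mul_inv_le_iff₀ (by positivity)]
      exact hsep i j hij
    have hj : ε * (1 + ‖f j‖)⁻¹ ≤ ‖f i - f j‖ := by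
      rw [mul_inv_le_iff₀ (by positivity), norm_sub_rev]
      exact hsep j i hij.symm
    rw [dist_eq_norm]
    linarith
  refine (summable_mul_left_iff hc.ne').1 (Summable.of_nonneg_of_le (fun i => by positivity)
    (fun i => hlow (f i)) (summable_setIntegral_of_pairwise_disjoint
      (integrable_one_add_norm (by simp)) (fun y => by positivity)
      (fun i => measurableSet_ball) hdisj))

end Separated

open scoped Matrix.Norms.Frobenius in
theorem exists_tsum_cosh_inv_pow_le {n : ℕ} (Γ : Subgroup (SU n)) [DiscreteTopology Γ] :
    ∃ N : ℕ, ∀ T : ℝ, ∃ S : ℝ, ∀ z p : Ball n, tau z (origin n) ≤ T → tau p (origin n) ≤ T →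
      Summable (fun γ : Γ => (Real.cosh (tau (γ • z) p / 2))⁻¹ ^ N) ∧
        ∑' γ : Γ, (Real.cosh (tau (γ • z) p / 2))⁻¹ ^ N ≤ S := by
  obtain ⟨ε, hε, hsep⟩ := exists_le_norm_mat_sub Γ
  have hsum := summable_one_add_norm_inv_pow_of_separated (f := fun γ : Γ => mat γ.1) hε hsep
  set N := 2 * Module.finrank ℝ (Matrix (Fin (n + 1)) (Fin (n + 1)) ℂ) + 1
  refine ⟨N, fun T => ⟨(2 * (n + 5) * Real.cosh T) ^ N * ∑' γ : Γ, (1 + ‖mat γ.1‖)⁻¹ ^ N,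
    fun z p hz hp => ?_⟩⟩
  have hle (γ : Γ) : (Real.cosh (tau (γ • z) p / 2))⁻¹ ^ N ≤
      (2 * (n + 5) * Real.cosh T) ^ N * (1 + ‖mat γ.1‖)⁻¹ ^ N := by
    have := Real.cosh_pos (tau (γ • z) p / 2)
    rw [← mul_pow]
    gcongr
    rw [← div_eq_mul_inv, inv_eq_one_div, div_le_div_iff₀ this (by positivity), one_mul]
    exact one_add_norm_mat_le_of_tau_le γ.1 hz hp
  have hsum' : Summable fun γ : Γ => (Real.cosh (tau (γ • z) p / 2))⁻¹ ^ N :=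
    .of_nonneg_of_le (fun γ => by have := Real.cosh_pos (tau (γ • z) p / 2); positivity) hle
      (hsum.mul_left _)
  exact ⟨hsum', (hsum'.tsum_le_tsum hle (hsum.mul_left _)).trans_eq tsum_mul_left⟩

section Bilinear

variable {α β E F G : Type*} [NormedAddCommGroup E] [NormedSpace ℝ E] [NormedAddCommGroup F]
  [NormedSpace ℝ F] [NormedAddCommGroup G] [NormedSpace ℝ G] (B : E →L[ℝ] F →L[ℝ] G)
  {f : α → E} {g : β → F} {u : α → ℝ} {v : β → ℝ}

theorem norm_bilin_integral_le [MeasurableSpace α] [MeasurableSpace β] {μ : Measure α}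
    {ν : Measure β} [CompleteSpace E] [CompleteSpace F] [CompleteSpace G] (hu0 : 0 ≤ u)
    (hv0 : 0 ≤ v) (hu : Integrable u μ) (hv : Integrable v ν)
    (h : ∀ᵐ a ∂μ, ∀ᵐ b ∂ν, ‖B (f a) (g b)‖ ≤ u a * v b) :
    ‖B (∫ a, f a ∂μ) (∫ b, g b ∂ν)‖ ≤ (∫ a, u a ∂μ) * ∫ b, v b ∂ν := by
  have hnonneg : 0 ≤ (∫ a, u a ∂μ) * ∫ b, v b ∂ν :=
    mul_nonneg (integral_nonneg hu0) (integral_nonneg hv0)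
  by_cases hf : Integrable f μ
  swap
  · rwa [integral_undef hf, map_zero, _root_.zero_apply, norm_zero]
  by_cases hg : Integrable g ν
  swap
  · rwa [integral_undef hg, map_zero, norm_zero]
  have hleft : ∀ᵐ a ∂μ, ‖B.flip (∫ b, g b ∂ν) (f a)‖ ≤ u a * ∫ b, v b ∂ν := by
    filter_upwards [h] with a ha
    rw [ContinuousLinearMap.flip_apply, ← ContinuousLinearMap.integral_comp_comm _ hg,
      ← integral_const_mul]
    exact norm_integral_le_of_norm_le (hv.const_mul (u a)) ha
  rw [← B.flip_apply, ← ContinuousLinearMap.integral_comp_comm _ hf, ← integral_mul_const]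
  exact norm_integral_le_of_norm_le (hu.mul_const _) hleft

theorem norm_bilin_tsum_le (hf : Summable f) (hg : Summable g) (hu : Summable u)
    (hv : Summable v) (h : ∀ a b, ‖B (f a) (g b)‖ ≤ u a * v b) :
    ‖B (∑' a, f a) (∑' b, g b)‖ ≤ (∑' a, u a) * ∑' b, v b := by
  have hleft (a : α) : ‖B.flip (∑' b, g b) (f a)‖ ≤ u a * ∑' b, v b := by
    rw [ContinuousLinearMap.flip_apply, ContinuousLinearMap.map_tsum _ hg]
    exact tsum_of_norm_bounded (hv.hasSum.mul_left (u a)) (h a)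
  rw [← B.flip_apply, ContinuousLinearMap.map_tsum _ hf]
  exact tsum_of_norm_bounded (hu.hasSum.mul_right _) hleft

end Bilinear

/-! ### The Bergman kernel and the reproducing constant -/

section Kernel

variable {n : ℕ}

/-- The value `n! / πⁿ` of the Bergman kernel at the centre of the ball. -/
def kernelConst (n : ℕ) : ℝ := n.factorial / Real.pi ^ n

theorem kernelConst_pos (n : ℕ) : 0 < kernelConst n := by
  unfold kernelConst
  positivity

theorem bergman_eq (z w : Ball n) :
    bergman z w = (kernelConst n : ℂ) / (-herm z w) ^ (n + 1) := by
  simp [bergman, kernelConst]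

theorem bergman_self (z : Ball n) :
    bergman z z = ((kernelConst n / (defect z ^ 2) ^ (n + 1) : ℝ) : ℂ) := by
  rw [bergman_eq, herm_self, neg_neg]
  push_cast
  rfl

theorem bergman_origin_right (z : Ball n) : bergman z (origin n) = kernelConst n := by
  simp [bergman_eq, herm_origin_right]

theorem bergman_origin_left (z : Ball n) : bergman (origin n) z = kernelConst n := by
  simp [bergman_eq, ← herm_conj z, herm_origin_right]

theorem bergmanDiag_eq (z : Ball n) :
    bergmanDiag z = kernelConst n / (defect z ^ 2) ^ (n + 1) := by
  rw [bergmanDiag, bergman_self, Complex.ofReal_re]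

theorem bergmanDiag_pos (z : Ball n) : 0 < bergmanDiag z := by
  have := kernelConst_pos n
  have := defect_pos z
  rw [bergmanDiag_eq]
  positivity

theorem bergmanDiag_le_of_tau_le {T : ℝ} {z : Ball n} (hz : tau z (origin n) ≤ T) :
    bergmanDiag z ≤ kernelConst n * (Real.cosh (T / 2) ^ 2) ^ (n + 1) := by
  have := kernelConst_pos n
  have hcosh := cosh_half_le_cosh_half (tau_nonneg z (origin n)) hz
  rw [cosh_half_tau_origin] at hcosh
  rw [bergmanDiag_eq, div_eq_mul_inv, ← inv_pow, ← inv_pow]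
  have := defect_pos z
  gcongr

theorem sqrt_bergmanDiag (z : Ball n) :
    √(bergmanDiag z) = √(kernelConst n) / defect z ^ (n + 1) := by
  rw [bergmanDiag_eq, Real.sqrt_div (kernelConst_pos n).le, pow_right_comm,
    Real.sqrt_sq (pow_pos (defect_pos z) _).le]

theorem bergmanDiag_rpow (z : Ball n) (k : ℕ) :
    bergmanDiag z ^ (-(k : ℝ) / 2) = (√(bergmanDiag z) ^ k)⁻¹ := by
  rw [neg_div, Real.rpow_neg (bergmanDiag_pos z).le, Real.rpow_div_two_eq_sqrt _
    (bergmanDiag_pos z).le, Real.rpow_natCast]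

theorem norm_jac_mul_norm_bergman (A : SU n) (z p : Ball n) :
    ‖jac A z‖ * ‖bergman (A • z) p‖ =
      √(bergmanDiag z) * √(bergmanDiag p) * (Real.cosh (tau (A • z) p / 2))⁻¹ ^ (n + 1) := by
  have := norm_pos_iff.2 (den_ne_zero A z.2)
  have := defect_pos (A • z)
  have := defect_pos p
  have := Real.cosh_pos (tau (A • z) p / 2)
  rw [jac, bergman_eq, norm_div, norm_div, norm_one, norm_pow, norm_pow, norm_neg, norm_herm_eq,
    Complex.norm_real, Real.norm_of_nonneg (kernelConst_pos n).le, sqrt_bergmanDiag,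
    sqrt_bergmanDiag, ← defect_smul_mul_norm_den A z]
  simp only [mul_pow, inv_pow]
  field_simp
  exact (Real.sq_sqrt (kernelConst_pos n).le).symm

theorem norm_jac_pow_mul_bergman_pow {Γ : Subgroup (SU n)} (γ : Γ) (k : ℕ) (z p : Ball n) :
    ‖jac (γ : SU n) z ^ k * bergman (γ • z) p ^ k‖ =
      √(bergmanDiag z) ^ k * √(bergmanDiag p) ^ k *
        (Real.cosh (tau (γ • z) p / 2))⁻¹ ^ ((n + 1) * k) := by
  rw [← mul_pow, norm_pow, norm_mul, pow_mul, ← mul_pow, ← mul_pow]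
  exact congrArg (· ^ k) (norm_jac_mul_norm_bergman (γ : SU n) z p)

theorem isOpen_ball (n : ℕ) : IsOpen {z : EuclideanSpace ℂ (Fin n) | ‖z‖ < 1} :=
  isOpen_lt continuous_norm continuous_const

theorem lebesgue_apply (s : Set (Ball n)) : lebesgue n s = volume (Subtype.val '' s) :=
  (MeasurableEmbedding.subtype_coe (isOpen_ball n).measurableSet).comap_apply _ _

instance : IsFiniteMeasure (lebesgue n) where
  measure_univ_lt_top := by
    rw [lebesgue_apply]
    refine (measure_mono (t := Metric.ball 0 1) ?_).trans_lt measure_ball_lt_top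
    rintro _ ⟨z, -, rfl⟩
    simpa only [mem_ball_zero_iff] using z.2

instance : (lebesgue n).IsOpenPosMeasure where
  open_pos U hU hne := by
    rw [lebesgue_apply]
    exact ((isOpen_ball n).isOpenMap_subtype_val U hU).measure_ne_zero _ (hne.image _)

theorem continuous_defect : Continuous (defect : Ball n → ℝ) := by
  unfold defect
  fun_prop

theorem defect_sq_le_one (z : Ball n) : defect z ^ 2 ≤ 1 := by
  rw [defect_sq]
  linarith [sq_nonneg ‖z.1‖]

theorem repConst_succ (n k : ℕ) :
    repConst n (k + 1) =
      (((kernelConst n * ∫ w, (defect w ^ 2) ^ ((n + 1) * k) ∂lebesgue n)⁻¹ : ℝ) : ℂ) := by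
  have hK : (kernelConst n : ℂ) ≠ 0 := Complex.ofReal_ne_zero.2 (kernelConst_pos n).ne'
  have hintegrand (w : Ball n) : bergman (origin n) w ^ (k + 1) * bergman w (origin n) ^ (k + 1) /
      bergman w w ^ (k + 1) * bergman w w =
      ((kernelConst n ^ (k + 2) * (defect w ^ 2) ^ ((n + 1) * k) : ℝ) : ℂ) := by
    have hw : (defect w : ℂ) ≠ 0 := Complex.ofReal_ne_zero.2 (defect_pos w).ne'
    rw [bergman_self, bergman_origin_left, bergman_origin_right]
    push_cast
    rw [pow_mul, div_pow]
    field_simp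
    ring
  simp_rw [repConst, hintegrand]
  rw [integral_complex_ofReal, integral_const_mul, bergman_origin_left]
  push_cast
  rw [mul_inv, pow_succ _ (k + 1), mul_assoc, div_mul_eq_div_div, div_self (pow_ne_zero _ hK),
    one_div, mul_inv]

/-- The mass of the Lebesgue measure near the centre keeps `∫ (1 - |w|²)^((n+1)k)` from decaying
at any given exponential rate. -/
theorem exists_norm_repConst_le (n : ℕ) {y : ℝ} (hy0 : 0 < y) (hy1 : y < 1) :
    ∃ A, ∀ k, 1 ≤ k → ‖repConst n k‖ ≤ A / y ^ ((n + 1) * k) := by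
  set V := {z : Ball n | y < defect z ^ 2}
  have hV : IsOpen V := isOpen_lt continuous_const (continuous_defect.pow 2)
  have hvol : 0 < (lebesgue n).real V := by
    refine ENNReal.toReal_pos (hV.measure_ne_zero _ ⟨origin n, ?_⟩) (measure_ne_top _ _)
    simpa only [V, Set.mem_ofPred_eq, defect_origin, one_pow]
  have hK := kernelConst_pos n
  refine ⟨(kernelConst n * (lebesgue n).real V)⁻¹, fun k hk => ?_⟩
  obtain ⟨k, rfl⟩ := Nat.exists_eq_add_of_le' hk
  have hint : Integrable (fun w => (defect w ^ 2) ^ ((n + 1) * k)) (lebesgue n) :=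
    Integrable.of_bound ((continuous_defect.pow 2).pow _).aestronglyMeasurable 1 <|
      .of_forall fun w => by
        rw [Real.norm_of_nonneg (by positivity)]
        exact pow_le_one₀ (sq_nonneg _) (defect_sq_le_one w)
  have hlower : y ^ ((n + 1) * (k + 1)) * (lebesgue n).real V ≤
      ∫ w, (defect w ^ 2) ^ ((n + 1) * k) ∂lebesgue n :=
    calc _ ≤ y ^ ((n + 1) * k) * (lebesgue n).real V := by
          gcongr ?_ * _
          exact pow_le_pow_of_le_one hy0.le hy1.le (by gcongr; exact k.le_succ)
      _ ≤ ∫ w in V, (defect w ^ 2) ^ ((n + 1) * k) ∂lebesgue n :=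
          setIntegral_ge_of_const_le_real hV.measurableSet (measure_ne_top _ _)
            (fun w hw => pow_le_pow_left₀ hy0.le (le_of_lt hw) _) hint.integrableOn
      _ ≤ _ := setIntegral_le_integral hint (.of_forall fun w => by positivity)
  rw [repConst_succ, Complex.norm_real, norm_inv, div_eq_mul_inv, ← mul_inv, norm_mul,
    Real.norm_of_nonneg hK.le, mul_assoc, mul_comm (Measure.real _ _)]
  gcongr
  exact hlower.trans (Real.le_norm_self _)

end Kernel

/-! ### Pairings of Poincaré series -/

section Pairing

/-- The pairing `Fᵀ Ḡ` on `ℂᵐ`; it is a real bilinear map, so that it can be moved past sums and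
integrals in both arguments. -/
def pairing (m : ℕ) : (Fin m → ℂ) →L[ℝ] (Fin m → ℂ) →L[ℝ] ℂ :=
  ∑ i, (ContinuousLinearMap.mul ℝ ℂ).bilinearComp (ContinuousLinearMap.proj i)
    ((Complex.conjCLE : ℂ →L[ℝ] ℂ).comp (ContinuousLinearMap.proj i))

theorem pairing_apply {m : ℕ} (F G : Fin m → ℂ) :
    pairing m F G = ∑ i, F i * starRingEnd ℂ (G i) := by
  simp [pairing]

theorem pairing_smul_smul {m : ℕ} (a b : ℂ) (F G : Fin m → ℂ) :
    pairing m (a • F) (b • G) = a * starRingEnd ℂ b * pairing m F G := by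
  simp only [pairing_apply, Finset.mul_sum, Pi.smul_apply, smul_eq_mul, map_mul]
  exact Finset.sum_congr rfl fun i _ => by ring

theorem pairing_unitary_mulVec_single {G : Type*} [Group G] {m : ℕ}
    (ρ : G →* Matrix.unitaryGroup (Fin m) ℂ) (γ γ' : G) (r j : Fin m) (a b : ℂ) :
    pairing m ((ρ γ⁻¹ : Matrix (Fin m) (Fin m) ℂ).mulVec (Pi.single r a))
      ((ρ γ'⁻¹ : Matrix (Fin m) (Fin m) ℂ).mulVec (Pi.single j b)) =
      a * starRingEnd ℂ b * (ρ (γ' * γ⁻¹) : Matrix (Fin m) (Fin m) ℂ) j r := by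
  have hadjoint : (ρ γ' : Matrix (Fin m) (Fin m) ℂ) =
      star (ρ γ'⁻¹ : Matrix (Fin m) (Fin m) ℂ) := by
    rw [map_inv, Matrix.UnitaryGroup.inv_val, star_star]
  rw [pairing_apply, map_mul, Matrix.UnitaryGroup.mul_val, hadjoint, Matrix.mul_apply,
    Finset.mul_sum]
  refine Finset.sum_congr rfl fun i _ => ?_
  simp only [Matrix.mulVec_single, Pi.smul_apply, Matrix.col_apply, MulOpposite.smul_eq_mul_unop,
    MulOpposite.unop_op, map_mul, Matrix.star_apply, RCLike.star_def]
  ring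

end Pairing

section Theta

variable {n m : ℕ} {Γ : Subgroup (SU n)} (ρ : Γ →* Matrix.unitaryGroup (Fin m) ℂ)

/-- The summand of index `γ` of the series defining `thetaPoint`. -/
def thetaTerm (j : Fin m) (k : ℕ) (p z : Ball n) (γ : Γ) : Fin m → ℂ :=
  jac (γ : SU n) z ^ k •
    (ρ γ⁻¹ : Matrix (Fin m) (Fin m) ℂ).mulVec (Pi.single j (bergman (γ • z) p ^ k))

theorem thetaPoint_eq (j : Fin m) (k : ℕ) (p z : Ball n) :
    thetaPoint Γ ρ j k p z = repConst n k • ∑' γ, thetaTerm ρ j k p z γ := rfl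

theorem norm_thetaTerm_le (j : Fin m) (k : ℕ) (p z : Ball n) (γ : Γ) :
    ‖thetaTerm ρ j k p z γ‖ ≤ √(bergmanDiag z) ^ k * √(bergmanDiag p) ^ k *
      (Real.cosh (tau (γ • z) p / 2))⁻¹ ^ ((n + 1) * k) := by
  refine le_of_le_of_eq ?_ (norm_jac_pow_mul_bergman_pow γ k z p)
  refine (pi_norm_le_iff_of_nonneg (norm_nonneg _)).2 fun i => ?_
  simp only [thetaTerm, Matrix.mulVec_single, Pi.smul_apply, smul_eq_mul, Matrix.col_apply,
    MulOpposite.smul_eq_mul_unop, MulOpposite.unop_op, norm_mul]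
  gcongr
  exact mul_le_of_le_one_left (norm_nonneg _) (entry_norm_bound_of_unitary (ρ γ⁻¹).2 i j)

theorem summable_thetaTerm {N k : ℕ} (hk : N ≤ (n + 1) * k) {p z : Ball n} (j : Fin m)
    (hN : Summable fun γ : Γ => (Real.cosh (tau (γ • z) p / 2))⁻¹ ^ N) :
    Summable (thetaTerm ρ j k p z) := by
  refine .of_norm_bounded (hN.mul_left (√(bergmanDiag z) ^ k * √(bergmanDiag p) ^ k)) fun γ => ?_
  refine (norm_thetaTerm_le ρ j k p z γ).trans ?_
  have hcosh := Real.one_le_cosh (tau (γ • z) p / 2)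
  gcongr ?_ * ?_
  exact pow_le_pow_of_le_one (by positivity) (inv_le_one_of_one_le₀ hcosh) hk

theorem norm_pairing_thetaTerm (r j : Fin m) (k : ℕ) (p q z : Ball n) (γ γ' : Γ) :
    ‖pairing m (thetaTerm ρ r k p z γ) (thetaTerm ρ j k q z γ')‖ =
      bergmanDiag z ^ k * (√(bergmanDiag p) ^ k * √(bergmanDiag q) ^ k) *
        (Real.cosh (tau (γ • z) p / 2) * Real.cosh (tau (γ' • z) q / 2))⁻¹ ^ ((n + 1) * k) *
          ‖(ρ (γ' * γ⁻¹) : Matrix (Fin m) (Fin m) ℂ) j r‖ := by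
  calc _ = ‖jac (γ : SU n) z ^ k * bergman (γ • z) p ^ k‖ *
        ‖jac (γ' : SU n) z ^ k * bergman (γ' • z) q ^ k‖ *
          ‖(ρ (γ' * γ⁻¹) : Matrix (Fin m) (Fin m) ℂ) j r‖ := by
        rw [thetaTerm, thetaTerm, pairing_smul_smul, pairing_unitary_mulVec_single]
        simp only [norm_mul, RCLike.norm_conj]
        ring
    _ = _ := by
        have hz : bergmanDiag z ^ k = √(bergmanDiag z) ^ k * √(bergmanDiag z) ^ k := by
          rw [← mul_pow, Real.mul_self_sqrt (bergmanDiag_pos z).le]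
        rw [norm_jac_pow_mul_bergman_pow, norm_jac_pow_mul_bergman_pow, hz, mul_inv, mul_pow]
        ring

theorem tau_mul_inv_smul_le (A B : SU n) (z p q : Ball n) :
    tau ((B * A⁻¹) • p) q ≤ tau (A • z) p + tau (B • z) q := by
  have htriangle := tau_triangle (B • A⁻¹ • p) (B • z) q
  rwa [tau_smul_smul, tau_comm _ z, tau_inv_smul_right, ← mul_smul] at htriangle

theorem cosh_quarter_sq_le_cosh_mul_cosh {δ : ℝ} (hδ : 0 ≤ δ) {A B : SU n} (z : Ball n)
    {p q : Ball n} (h : δ ≤ tau ((B * A⁻¹) • p) q) :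
    Real.cosh (δ / 4) ^ 2 ≤ Real.cosh (tau (A • z) p / 2) * Real.cosh (tau (B • z) q / 2) := by
  refine le_trans ?_ (cosh_quarter_add_sq_le _ _)
  have hle := h.trans (tau_mul_inv_smul_le A B z p q)
  gcongr
  rw [Real.cosh_le_cosh, abs_of_nonneg, abs_of_nonneg] <;> linarith

theorem inv_pow_le_div_pow_mul_inv_pow {κ x : ℝ} (hκ : 0 < κ) (hx : κ ≤ x) {N M : ℕ}
    (hNM : N ≤ M) : x⁻¹ ^ M ≤ κ ^ N / κ ^ M * x⁻¹ ^ N := by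
  obtain ⟨d, rfl⟩ := Nat.exists_eq_add_of_le hNM
  have := hκ.trans_le hx
  calc x⁻¹ ^ (N + d) = x⁻¹ ^ d * x⁻¹ ^ N := by rw [pow_add, mul_comm]
    _ ≤ κ⁻¹ ^ d * x⁻¹ ^ N := by gcongr
    _ = _ := by rw [pow_add, div_mul_cancel_left₀ (by positivity), inv_pow κ]

theorem norm_pairing_thetaTerm_le {δ : ℝ} (hδ : 0 ≤ δ) {r j : Fin m} {p q : Ball n}
    (h : ∀ η : Γ, (ρ η : Matrix (Fin m) (Fin m) ℂ) j r = 0 ∨ δ ≤ tau (η • p) q) {N k : ℕ}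
    (hk : N ≤ (n + 1) * k) (z : Ball n) (γ γ' : Γ) :
    ‖pairing m (thetaTerm ρ r k p z γ) (thetaTerm ρ j k q z γ')‖ ≤
      bergmanDiag z ^ k * (√(bergmanDiag p) ^ k * √(bergmanDiag q) ^ k) *
        ((Real.cosh (δ / 4) ^ 2) ^ N / (Real.cosh (δ / 4) ^ 2) ^ ((n + 1) * k)) *
          (Real.cosh (tau (γ • z) p / 2))⁻¹ ^ N * (Real.cosh (tau (γ' • z) q / 2))⁻¹ ^ N := by
  have := bergmanDiag_pos z
  have := Real.cosh_pos (δ / 4)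
  have := Real.cosh_pos (tau (γ • z) p / 2)
  have := Real.cosh_pos (tau (γ' • z) q / 2)
  rw [norm_pairing_thetaTerm]
  rcases h (γ' * γ⁻¹) with hentry | hdist
  · rw [hentry, norm_zero, mul_zero]
    positivity
  have hκ : Real.cosh (δ / 4) ^ 2 ≤
      Real.cosh (tau (γ • z) p / 2) * Real.cosh (tau (γ' • z) q / 2) :=
    cosh_quarter_sq_le_cosh_mul_cosh hδ z hdist
  have hdecay := inv_pow_le_div_pow_mul_inv_pow (by positivity) hκ hk
  calc _ ≤ bergmanDiag z ^ k * (√(bergmanDiag p) ^ k * √(bergmanDiag q) ^ k) *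
        (Real.cosh (tau (γ • z) p / 2) * Real.cosh (tau (γ' • z) q / 2))⁻¹ ^ ((n + 1) * k) :=
        mul_le_of_le_one_right (by positivity) (entry_norm_bound_of_unitary (ρ (γ' * γ⁻¹)).2 j r)
    _ ≤ _ := mul_le_mul_of_nonneg_left hdecay (by positivity)
    _ = _ := by
        rw [mul_inv, mul_pow (_)⁻¹]
        ring

theorem norm_pairing_thetaPoint_le {δ : ℝ} (hδ : 0 ≤ δ) {r j : Fin m} {p q z : Ball n}
    (h : ∀ η : Γ, (ρ η : Matrix (Fin m) (Fin m) ℂ) j r = 0 ∨ δ ≤ tau (η • p) q) {N k : ℕ}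
    (hk : N ≤ (n + 1) * k) {S : ℝ}
    (hp : (Summable fun γ : Γ => (Real.cosh (tau (γ • z) p / 2))⁻¹ ^ N) ∧
      ∑' γ : Γ, (Real.cosh (tau (γ • z) p / 2))⁻¹ ^ N ≤ S)
    (hq : (Summable fun γ : Γ => (Real.cosh (tau (γ • z) q / 2))⁻¹ ^ N) ∧
      ∑' γ : Γ, (Real.cosh (tau (γ • z) q / 2))⁻¹ ^ N ≤ S) :
    ‖pairing m (thetaPoint Γ ρ r k p z) (thetaPoint Γ ρ j k q z)‖ ≤
      ‖repConst n k‖ ^ 2 * (bergmanDiag z ^ k * (√(bergmanDiag p) ^ k * √(bergmanDiag q) ^ k) *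
        ((Real.cosh (δ / 4) ^ 2) ^ N / (Real.cosh (δ / 4) ^ 2) ^ ((n + 1) * k)) * S ^ 2) := by
  have := bergmanDiag_pos z
  have := Real.cosh_pos (δ / 4)
  have hnonneg (p : Ball n) : 0 ≤ ∑' γ : Γ, (Real.cosh (tau (γ • z) p / 2))⁻¹ ^ N :=
    tsum_nonneg fun γ => pow_nonneg (inv_nonneg.2 (Real.cosh_pos _).le) _
  have hbound := norm_bilin_tsum_le (pairing m) (summable_thetaTerm ρ hk r hp.1)
    (summable_thetaTerm ρ hk j hq.1) (hp.1.mul_left _) hq.1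
    (norm_pairing_thetaTerm_le ρ hδ h hk z)
  rw [thetaPoint_eq, thetaPoint_eq, pairing_smul_smul, norm_mul, norm_mul, RCLike.norm_conj, ← sq]
  gcongr
  refine hbound.trans ?_
  rw [tsum_mul_left, mul_assoc, sq S]
  gcongr
  · exact (hnonneg p).trans hp.2
  · exact hp.2
  · exact hq.2

/-- `∫ Θ_p^{(j;k)}(z) 𝒦(p,p)^{-k/2} u(p) dμ(p)`. The function `thetaSub` of an oriented submanifold
`X` is the case where `μ` is the Euclidean volume of `X` and `u` the density of `ν`. -/
def thetaIntegral (μ : Measure (Ball n)) (u : Ball n → ℝ) (j : Fin m) (k : ℕ) (z : Ball n) :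
    Fin m → ℂ :=
  ∫ p, u p • (bergmanDiag p ^ (-(k : ℝ) / 2)) • thetaPoint Γ ρ j k p z ∂μ

variable {ρ} {μ ν : Measure (Ball n)} {u v : Ball n → ℝ} {δ S T : ℝ} {N : ℕ}

theorem norm_pairing_thetaIntegral_le (hu : Integrable u μ) (hv : Integrable v ν)
    (hμ : ∀ᵐ p ∂μ, tau p (origin n) ≤ T) (hν : ∀ᵐ q ∂ν, tau q (origin n) ≤ T)
    (hS : ∀ z p : Ball n, tau z (origin n) ≤ T → tau p (origin n) ≤ T →
      (Summable fun γ : Γ => (Real.cosh (tau (γ • z) p / 2))⁻¹ ^ N) ∧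
        ∑' γ : Γ, (Real.cosh (tau (γ • z) p / 2))⁻¹ ^ N ≤ S)
    (hδ : 0 ≤ δ) {r j : Fin m}
    (h : ∀ᵐ p ∂μ, ∀ᵐ q ∂ν, ∀ η : Γ,
      (ρ η : Matrix (Fin m) (Fin m) ℂ) j r = 0 ∨ δ ≤ tau (η • p) q)
    {k : ℕ} (hk : N ≤ (n + 1) * k) {z : Ball n} (hz : tau z (origin n) ≤ T) :
    ‖pairing m (thetaIntegral ρ μ u r k z) (thetaIntegral ρ ν v j k z)‖ ≤
      ‖repConst n k‖ ^ 2 * bergmanDiag z ^ k *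
        ((Real.cosh (δ / 4) ^ 2) ^ N / (Real.cosh (δ / 4) ^ 2) ^ ((n + 1) * k)) * S ^ 2 *
          (∫ p, |u p| ∂μ) * ∫ q, |v q| ∂ν := by
  have hz0 := bergmanDiag_pos z
  rw [← integral_const_mul _ fun p => |u p|]
  refine norm_bilin_integral_le (pairing m) (fun p => by positivity) (fun q => abs_nonneg _)
    (hu.abs.const_mul _) hv.abs ?_
  filter_upwards [hμ, h] with p hp hpq
  filter_upwards [hν, hpq] with q hq hη
  have hbound := norm_pairing_thetaPoint_le ρ hδ hη hk (hS z p hz hp) (hS z q hz hq)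
  have hp0 : 0 < √(bergmanDiag p) ^ k := pow_pos (Real.sqrt_pos.2 (bergmanDiag_pos p)) k
  have hq0 : 0 < √(bergmanDiag q) ^ k := pow_pos (Real.sqrt_pos.2 (bergmanDiag_pos q)) k
  simp only [bergmanDiag_rpow, map_smul, _root_.smul_apply, norm_smul, Real.norm_eq_abs, abs_inv,
    abs_of_pos hp0, abs_of_pos hq0]
  calc _ = |u p| * |v q| * ((√(bergmanDiag p) ^ k)⁻¹ * (√(bergmanDiag q) ^ k)⁻¹) *
        ‖pairing m (thetaPoint Γ ρ r k p z) (thetaPoint Γ ρ j k q z)‖ := by ring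
    _ ≤ _ := mul_le_mul_of_nonneg_left hbound (by positivity)
    _ = _ := by field_simp

end Theta

/-! ### Decay of the inner product -/

section Decay

variable {n : ℕ}

theorem exists_sq_norm_repConst_le (n : ℕ) {c : ℝ} (hc : 1 < c) :
    ∃ A : ℝ, ∀ k, 1 ≤ k → ‖repConst n k‖ ^ 2 ≤ A * c ^ ((n + 1) * k) := by
  have hsqrt : 1 < √c := Real.lt_sqrt_of_sq_lt (by rwa [one_pow])
  obtain ⟨A, hA⟩ := exists_norm_repConst_le n (inv_pos.2 (zero_lt_one.trans hsqrt))
    (inv_lt_one_of_one_lt₀ hsqrt)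
  refine ⟨A ^ 2, fun k hk => (pow_le_pow_left₀ (norm_nonneg _) (hA k hk) 2).trans_eq ?_⟩
  rw [div_pow, pow_right_comm, inv_pow, Real.sq_sqrt (zero_lt_one.trans hc).le, inv_pow,
    div_inv_eq_mul]

theorem norm_petersson_le {m : ℕ} {Γ : Subgroup (SU n)} {p₀ : Ball n} {T : ℝ}
    (hT : ∀ z ∈ dirichlet Γ p₀, tau z (origin n) ≤ T) {k : ℕ} {F G : Ball n → Fin m → ℂ} {B : ℝ}
    (h : ∀ z ∈ dirichlet Γ p₀, ‖pairing m (F z) (G z)‖ ≤ B * bergmanDiag z ^ k) :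
    ‖petersson Γ p₀ k F G‖ ≤ B * (kernelConst n * (Real.cosh (T / 2) ^ 2) ^ (n + 1)) *
      (lebesgue n).real (dirichlet Γ p₀) := by
  refine norm_setIntegral_le_of_norm_le_const (measure_lt_top _ _) fun z hz => ?_
  have hz0 := bergmanDiag_pos z
  have hB : 0 ≤ B := nonneg_of_mul_nonneg_left ((norm_nonneg _).trans (h z hz)) (by positivity)
  rw [← pairing_apply, norm_mul, Complex.norm_real, Real.norm_of_nonneg (by positivity)]
  calc _ ≤ B * bergmanDiag z ^ k * ((bergmanDiag z)⁻¹ ^ k * bergmanDiag z) := by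
        gcongr
        exact h z hz
    _ = B * bergmanDiag z := by
        rw [inv_pow]
        field_simp
    _ ≤ _ := by
        gcongr
        exact bergmanDiag_le_of_tau_le (hT z hz)

theorem exists_norm_petersson_thetaIntegral_le (Γ : Subgroup (SU n)) [DiscreteTopology Γ]
    [CompactSpace (BallQuot Γ)] (p₀ : Ball n) {μ ν : Measure (Ball n)} {u v : Ball n → ℝ}
    (hu : Integrable u μ) (hv : Integrable v ν) {T δ : ℝ} (hδ : 0 < δ)
    (hμ : ∀ᵐ p ∂μ, tau p (origin n) ≤ T) (hν : ∀ᵐ q ∂ν, tau q (origin n) ≤ T) :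
    ∃ (C : ℝ) (k₀ : ℕ), ∀ (m : ℕ) (ρ : Γ →* Matrix.unitaryGroup (Fin m) ℂ) (r j : Fin m),
      (∀ᵐ p ∂μ, ∀ᵐ q ∂ν, ∀ η : Γ,
        (ρ η : Matrix (Fin m) (Fin m) ℂ) j r = 0 ∨ δ ≤ tau (η • p) q) →
      ∀ k, k₀ ≤ k → ‖petersson Γ p₀ k (thetaIntegral ρ μ u r k) (thetaIntegral ρ ν v j k)‖ ≤
        C / (Real.cosh (δ / 4) ^ (n + 1)) ^ k := by
  obtain ⟨T₀, hT₀⟩ := exists_tau_origin_le_of_mem_dirichlet Γ p₀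
  obtain ⟨N, hN⟩ := exists_tsum_cosh_inv_pow_le Γ
  obtain ⟨S, hS⟩ := hN (max T T₀)
  set c := Real.cosh (δ / 4)
  have hc : 1 < c := Real.one_lt_cosh.2 (by positivity)
  obtain ⟨A, hA⟩ := exists_sq_norm_repConst_le n hc
  set I := ∫ p, |u p| ∂μ
  set J := ∫ q, |v q| ∂ν
  have : 0 ≤ I := integral_nonneg fun _ => abs_nonneg _
  have : 0 ≤ J := integral_nonneg fun _ => abs_nonneg _
  refine ⟨A * (c ^ 2) ^ N * S ^ 2 * I * J * (kernelConst n * (Real.cosh (T₀ / 2) ^ 2) ^ (n + 1)) *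
    (lebesgue n).real (dirichlet Γ p₀), N + 1, fun m ρ r j h k hk => ?_⟩
  have hNk : N ≤ (n + 1) * k :=
    (Nat.le_of_succ_le hk).trans (Nat.le_mul_of_pos_left k n.succ_pos)
  have hpair (z : Ball n) (hz : z ∈ dirichlet Γ p₀) :
      ‖pairing m (thetaIntegral ρ μ u r k z) (thetaIntegral ρ ν v j k z)‖ ≤
        A * (c ^ 2) ^ N / c ^ ((n + 1) * k) * S ^ 2 * I * J * bergmanDiag z ^ k := by
    have hz0 := bergmanDiag_pos z
    calc _ ≤ ‖repConst n k‖ ^ 2 * bergmanDiag z ^ k * ((c ^ 2) ^ N / (c ^ 2) ^ ((n + 1) * k)) *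
          S ^ 2 * I * J :=
        norm_pairing_thetaIntegral_le hu hv (hμ.mono fun _ => le_max_of_le_left)
          (hν.mono fun _ => le_max_of_le_left) hS hδ.le h hNk (le_max_of_le_right (hT₀ z hz))
      _ ≤ A * c ^ ((n + 1) * k) * bergmanDiag z ^ k *
          ((c ^ 2) ^ N / (c ^ 2) ^ ((n + 1) * k)) * S ^ 2 * I * J := by
        gcongr
        exact hA k (Nat.le_of_add_left_le hk)
      _ = _ := by
        rw [pow_right_comm c 2 ((n + 1) * k)]
        field_simp
  refine (norm_petersson_le hT₀ hpair).trans_eq ?_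
  rw [← pow_mul]
  ring

theorem exists_div_pow_le_div_pow {c : ℝ} (hc : 1 < c) (C : ℝ) (k₀ l : ℕ) :
    ∃ (D : ℝ) (k₁ : ℕ), ∀ k, k₁ ≤ k → k₀ ≤ k ∧ C / c ^ k ≤ D / (k : ℝ) ^ l := by
  obtain ⟨D, hD⟩ := ((tendsto_pow_const_div_const_pow_of_one_lt l hc).const_mul C).bddAbove_range
  refine ⟨D, k₀ + 1, fun k hk => ⟨Nat.le_of_succ_le hk, ?_⟩⟩
  have hk0 : 0 < k := Nat.zero_lt_of_lt hk
  rw [le_div_iff₀ (by positivity), div_mul_eq_mul_div, mul_div_assoc]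
  exact hD ⟨k, rfl⟩

end Decay

/-! ### Submanifolds of the fundamental domain -/

section Submanifold

variable {n q : ℕ} {Γ : Subgroup (SU n)} {p₀ : Ball n} {X' : Set (BallQuot Γ)} {X : Set (Ball n)}
  {o ν : FormField n q}

theorem IsSubmanifold.isLocallyClosed {S : Set (EuclideanSpace ℂ (Fin n))}
    (hS : IsSubmanifold q S) : IsLocallyClosed S := by
  refine ((isLocallyClosed_tfae S).out 0 3).2 fun x hx => ?_
  obtain ⟨Φ, W, hxΦ, -, -, -, hΦ⟩ := hS x hx
  have himage : Φ.IsImage S W :=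
    .of_image_eq (by rw [Set.inter_comm, hΦ, Set.inter_comm])
  refine ⟨Φ.source, hxΦ, Φ.open_source, fun y ⟨hy, hyS⟩ => ?_⟩
  have hyW : Φ y ∈ closure (W : Set (EuclideanSpace ℂ (Fin n))) :=
    (himage.closure.apply_mem_iff hy).2 hyS
  rw [W.closed_of_finiteDimensional.closure_eq] at hyW
  exact (himage.apply_mem_iff hy).1 hyW

theorem IsSubmanifold.measurableSet (hX : IsSubmanifold q (ambient X)) :
    MeasurableSet X := by
  obtain ⟨U, Z, hU, hZ, hUZ⟩ := hX.isLocallyClosed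
  rw [← Set.preimage_image_eq X Subtype.val_injective, ← ambient, hUZ]
  exact measurable_subtype_coe (hU.measurableSet.inter hZ.measurableSet)

theorem IsSubmanifoldWithForm.subset_dirichlet
    (hX : IsSubmanifoldWithForm Γ p₀ q X' X o ν) : X ⊆ dirichlet Γ p₀ :=
  hX.eq_inter.le.trans Set.inter_subset_right

theorem IsSubmanifoldWithForm.ae_mem
    (hX : IsSubmanifoldWithForm Γ p₀ q X' X o ν) :
    ∀ᵐ x ∂(μHE[q] : Measure (Ball n)).restrict X, x ∈ X :=
  ae_restrict_mem hX.submanifold.measurableSet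

theorem IsSubmanifoldWithForm.smul_eq_of_mem
    (hX : IsSubmanifoldWithForm Γ p₀ q X' X o ν) {γ : Γ} {p : Ball n} (hp : p ∈ X)
    (hγ : γ • p ∈ X) : γ • p = p :=
  hX.bijOn.injOn hγ hp (Quotient.sound ⟨γ, rfl⟩)

end Submanifold

end BallQuotient

end

open BallQuotient in
theorem theorem4p1_general {n : ℕ} (Γ : Subgroup (SU n)) [DiscreteTopology Γ]
    [CompactSpace (BallQuot Γ)] (p₀ : Ball n) {X Y : Set (Ball n)} {T : ℝ}
    (hXT : ∀ p ∈ X, tau p (origin n) ≤ T) (hYT : ∀ q ∈ Y, tau q (origin n) ≤ T)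
    {μ ν : Measure (Ball n)} (hμ : ∀ᵐ p ∂μ, p ∈ X) (hν : ∀ᵐ q ∂ν, q ∈ Y)
    {u v : Ball n → ℝ} (hu : Integrable u μ) (hv : Integrable v ν) :
    (0 < setDist (saturation Γ X \ X) Y →
      ∃ (C : ℝ) (k₀ : ℕ), ∀ (m : ℕ) (ρ : Γ →* Matrix.unitaryGroup (Fin m) ℂ),
        (∀ γ : Γ, ∀ p ∈ X, γ • p ∈ X → ρ γ = 1) →
        ∀ r j : Fin m, r ≠ j → ∀ k, k₀ ≤ k →
          ‖petersson Γ p₀ k (thetaIntegral ρ μ u r k) (thetaIntegral ρ ν v j k)‖ ≤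
            C / (Real.cosh (setDist (saturation Γ X \ X) Y / 4) ^ (n + 1)) ^ k) ∧
    (0 < setDist (saturation Γ X) Y →
      ∃ (C : ℝ) (k₀ : ℕ), ∀ (m : ℕ) (ρ : Γ →* Matrix.unitaryGroup (Fin m) ℂ),
        ∀ r j : Fin m, ∀ k, k₀ ≤ k →
          ‖petersson Γ p₀ k (thetaIntegral ρ μ u r k) (thetaIntegral ρ ν v j k)‖ ≤
            C / (Real.cosh (setDist (saturation Γ X) Y / 4) ^ (n + 1)) ^ k) := by
  have hdecay {δ : ℝ} (hδ : 0 < δ) := exists_norm_petersson_thetaIntegral_le Γ p₀ hu hv hδ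
    (hμ.mono hXT) (hν.mono hYT)
  refine ⟨fun hdist => ?_, fun hdist => ?_⟩ <;> obtain ⟨C, k₀, h⟩ := hdecay hdist
  · refine ⟨C, k₀, fun m ρ hρ r j hrj => h m ρ r j ?_⟩
    filter_upwards [hμ] with p hp
    filter_upwards [hν] with q hq η
    by_cases hη : η • p ∈ X
    · left
      rw [hρ η p hp hη]
      exact Matrix.one_apply_ne hrj.symm
    · exact .inr (setDist_le ⟨⟨η, p, hp, rfl⟩, hη⟩ hq)
  · refine ⟨C, k₀, fun m ρ r j => h m ρ r j ?_⟩
    filter_upwards [hμ] with p hp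
    filter_upwards [hν] with q hq η
    exact .inr (setDist_le ⟨η, p, hp, rfl⟩ hq)

theorem theorem4p1 (n : ℕ) (hn : 1 ≤ n) (Γ : Subgroup (BallQuotient.SU n))
    (hdiscrete : DiscreteTopology Γ) (hcompact : CompactSpace (BallQuotient.BallQuot Γ))
    (hfree : ∀ (γ : Γ) (z : BallQuotient.Ball n), γ • z = z →
      ∀ w : BallQuotient.Ball n, γ • w = w)
    (p₀ : BallQuotient.Ball n)
    (qX qY : ℕ) (X' Y' : Set (BallQuotient.BallQuot Γ)) (X Y : Set (BallQuotient.Ball n))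
    (oX νX : BallQuotient.FormField n qX) (oY νY : BallQuotient.FormField n qY)
    (hX : BallQuotient.IsSubmanifoldWithForm Γ p₀ qX X' X oX νX)
    (hY : BallQuotient.IsSubmanifoldWithForm Γ p₀ qY Y' Y oY νY) :
    (0 < BallQuotient.setDist (BallQuotient.saturation Γ X \ X) Y →
      ∀ l : ℕ, ∃ (C : ℝ) (k₀ : ℕ), ∀ (m : ℕ) (ρ : Γ →* Matrix.unitaryGroup (Fin m) ℂ),
        (∀ γ : Γ, (∀ w : BallQuotient.Ball n, γ • w = w) → ρ γ = 1) →
        ∀ r j : Fin m, r ≠ j → ∀ k : ℕ, k₀ ≤ k →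
          ‖BallQuotient.petersson Γ p₀ k (BallQuotient.thetaSub Γ ρ X oX νX r k)
            (BallQuotient.thetaSub Γ ρ Y oY νY j k)‖ ≤ C / (k : ℝ) ^ l) ∧
    (0 < BallQuotient.setDist (BallQuotient.saturation Γ X) Y →
      ∀ l : ℕ, ∃ (C : ℝ) (k₀ : ℕ), ∀ (m : ℕ) (ρ : Γ →* Matrix.unitaryGroup (Fin m) ℂ),
        ∀ r j : Fin m, ∀ k : ℕ, k₀ ≤ k →
          ‖BallQuotient.petersson Γ p₀ k (BallQuotient.thetaSub Γ ρ X oX νX r k)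
            (BallQuotient.thetaSub Γ ρ Y oY νY j k)‖ ≤ C / (k : ℝ) ^ l) := by
  obtain ⟨T, hT⟩ := BallQuotient.exists_tau_origin_le_of_mem_dirichlet Γ p₀
  have hgeneral := theorem4p1_general Γ p₀ (fun p hp => hT p (hX.subset_dirichlet hp))
    (fun q hq => hT q (hY.subset_dirichlet hq)) hX.ae_mem hY.ae_mem hX.integrable hY.integrable
  have hrate {δ : ℝ} (hδ : 0 < δ) : 1 < Real.cosh (δ / 4) ^ (n + 1) :=
    one_lt_pow₀ (Real.one_lt_cosh.2 (by positivity)) n.succ_ne_zero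
  refine ⟨fun hdist l => ?_, fun hdist l => ?_⟩
  · obtain ⟨C, k₀, h⟩ := hgeneral.1 hdist
    obtain ⟨D, k₁, hD⟩ := BallQuotient.exists_div_pow_le_div_pow (hrate hdist) C k₀ l
    exact ⟨D, k₁, fun m ρ hρ r j hrj k hk =>
      (h m ρ (fun γ p hp hγ => hρ γ (hfree γ p (hX.smul_eq_of_mem hp hγ))) r j hrj k
        (hD k hk).1).trans (hD k hk).2⟩
  · obtain ⟨C, k₀, h⟩ := hgeneral.2 hdist
    obtain ⟨D, k₁, hD⟩ := BallQuotient.exists_div_pow_le_div_pow (hrate hdist) C k₀ l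
    exact ⟨D, k₁, fun m ρ r j k hk => (h m ρ r j k (hD k hk).1).trans (hD k hk).2⟩
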